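/- **Setting.** Let $(x_i,y_i)$, $i\in I=\{0,\dots,N-1\}$, be data with $x_i\in\mathbb{R}^d$ and $y_i\in\{-1,+1\}$, and let $I=\biguplus_{m=0}^{M-1} I_m$ be a partition into $M$ tasks. For a differentiable loss $\ell:\mathbb{R}\to\mathbb{R}$ put $\mathcal{L}_m(w)=\sum_{i\in I_m}\ell(y_ix_i^\top w)$. Cyclic sequential gradient descent with learning rate $\eta>0$, budget $K\ge 1$ and arbitrary initial point $w_0^{(0)}=w_0\in\mathbb{R}^d$ is $$w^{(t)}_{k+1}=w^{(t)}_k-\eta\nabla\mathcal{L}_{t\bmod M}(w^{(t)}_k)\quad(0\le k\le K-1),\qquad w^{(t+1)}_0=w^{(t)}_K\qquad(t\ge 0).$$ **Assumptions.** 1. (Joint separability) There is $w$ with $y_ix_i^\top w>0$ for all $i\in I$. Let $\hat w$ be the unique minimizer of $\|w\|^2$ subject to $y_ix_i^\top w\ge 1$ for all $i\in I$, let $\phi=\min_{i\in I} y_ix_i^\top\hat w/\|\hat w\|$, and let $S=\{i\in I: y_ix_i^\top\hat w/\|\hat w\|=\phi\}$ be the set of support indices. 2. (Non-degeneracy) There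 are unique coefficients $\alpha_i>0$ $(i\in S)$ with $\hat w=\sum_{i\in S}\alpha_iy_ix_i$. 3. (Loss shape) $\ell$ is positive and differentiable, $\ell'$ is $\beta$-Lipschitz, $\ell'<0$ everywhere, $\lim_{u\to\infty}\ell(u)=0$, and $\limsup_{u\to-\infty}\ell'(u)<0$. 4. (Tight exponential tail) There are $\mu_+,\mu_-,\bar u>0$ such that $(1-e^{-\mu_-u})e^{-u}\le-\ell'(u)\le(1+e^{-\mu_+u})e^{-u}$ for all $u>\bar u$. 5. (Learning rate) $\displaystyle\eta<\frac{\phi^2}{2K\beta\sigma_{\max}^3(M\phi+\sigma_{\max})}$, where $\sigma_{\max}$ is the largest singular value of the matrix with columns $x_i$, $i\in I$. 6. (Support vectors span the data) $\operatorname{rank}\{x_i:i\in S\}=\operatorname{rank}\{x_i:i\in I\}$. **Conclusion.** Let $P$ be the orthogonal projection of $\mathbb{R}^d$ onto $\operatorname{span}\{x_i:i\in S\}$. The system $$\eta\exp(-y_ix_i^\top\tilde w)=\alpha_i\quad(i\in S),\qquad (I-P)(\tilde w-w_0)=0$$ has a unique solution $\tilde w\in\mathbb{R}^d$, and the residual $\rho^{(t)}_k$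 defined by $$w^{(t)}_k=\ln\!\Big(\frac{K}{M}\,t\Big)\hat w+\rho^{(t)}_k\qquad(t\ge 1)$$ satisfies $\lim_{t\to\infty}\rho^{(t)}_k=\tilde w$ for every $k\in\{0,\dots,K-1\}$. (Equivalently, $w^{(t)}_k-\ln(t)\,\hat w\to\tilde w+\ln(K/M)\,\hat w$.) -/

import Mathlib

open Filter Topology

noncomputable section

namespace SeqGD

/-- A binary classification dataset `(x i, y i)`, `i < N`, in `ℝ^d` with labels `±1`, whose index set
is partitioned into `M` tasks: `task i` is the task that data point `i` belongs to. -/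
structure TaskData (d N M : ℕ) where
  x : Fin N → EuclideanSpace ℝ (Fin d)
  y : Fin N → ℝ
  y_eq : ∀ i, y i = 1 ∨ y i = -1
  task : Fin N → Fin M

/-- `ℓ` is positive, `β`-smooth, monotonically decreasing to zero (with `ℓ' < 0`), and
`limsup_{u → -∞} ℓ'(u) < 0`. The last condition is spelled out as an eventual bound by a negative
constant, so that it also covers derivatives that are unbounded below near `-∞`. -/
structure LossShape (ℓ : ℝ → ℝ) (β : ℝ) : Prop where
  pos : ∀ u, 0 < ℓ u
  differentiable : Differentiable ℝ ℓ
  smooth : ∀ u v, |deriv ℓ u - deriv ℓ v| ≤ β * |u - v|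
  deriv_neg : ∀ u, deriv ℓ u < 0
  tendsto_zero : Tendsto ℓ atTop (𝓝 0)
  limsup_deriv_neg : ∃ c < 0, ∀ᶠ u in atBot, deriv ℓ u ≤ c

/-- `-ℓ'` has a tight exponential tail. -/
def TightExponentialTail (ℓ : ℝ → ℝ) : Prop :=
  ∃ μp > 0, ∃ μm > 0, ∃ ubar > 0, ∀ u : ℝ, ubar < u →
    (1 - Real.exp (-(μm * u))) * Real.exp (-u) ≤ -deriv ℓ u ∧
      -deriv ℓ u ≤ (1 + Real.exp (-(μp * u))) * Real.exp (-u)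

namespace TaskData

variable {d N M : ℕ} (D : TaskData d N M)

/-- The data matrix `X ∈ ℝ^{d × N}`, whose columns are the data points. -/
def dataMatrix : Matrix (Fin d) (Fin N) ℝ := Matrix.of fun a i => D.x i a

/-- The maximum singular value of the data matrix. -/
def sigmaMax : ℝ := (Matrix.toEuclideanLin D.dataMatrix).singularValues 0

/-- The joint data are linearly separable. -/
def Separable : Prop :=
  ∃ w : EuclideanSpace ℝ (Fin d), ∀ i, 0 < D.y i * inner ℝ (D.x i) w

/-- The constraint set `{w | y_i x_iᵀ w ≥ 1 for all i}`. -/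
def feasible : Set (EuclideanSpace ℝ (Fin d)) :=
  {w | ∀ i, 1 ≤ D.y i * inner ℝ (D.x i) w}

/-- `w` solves `min ‖w‖²` subject to `y_i x_iᵀ w ≥ 1` for all `i`. -/
def IsMaxMargin (w : EuclideanSpace ℝ (Fin d)) : Prop :=
  w ∈ D.feasible ∧ ∀ v ∈ D.feasible, ‖w‖ ^ 2 ≤ ‖v‖ ^ 2

/-- The joint `ℓ²` max-margin solution `ŵ`; for separable data it is the unique solution of the
max-margin problem, see `existsUnique_isMaxMargin` and `isMaxMargin_maxMargin`. -/
def maxMargin : EuclideanSpace ℝ (Fin d) := Classical.epsilon D.IsMaxMargin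

theorem feasible_nonempty (h : D.Separable) : D.feasible.Nonempty := by
  obtain ⟨w, hw⟩ := h
  rcases isEmpty_or_nonempty (Fin N) with hN | hN
  · exact ⟨w, fun i => hN.elim i⟩
  · obtain ⟨j, hj⟩ := Finite.exists_min fun i => D.y i * inner ℝ (D.x i) w
    refine ⟨(D.y j * inner ℝ (D.x j) w)⁻¹ • w, fun i => ?_⟩
    have h1 : D.y i * inner ℝ (D.x i) ((D.y j * inner ℝ (D.x j) w)⁻¹ • w)
        = (D.y j * inner ℝ (D.x j) w)⁻¹ * (D.y i * inner ℝ (D.x i) w) := by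
      rw [inner_smul_right]; ring
    rw [h1, ← div_eq_inv_mul, le_div_iff₀ (hw j), one_mul]
    exact hj i

theorem convex_feasible : Convex ℝ D.feasible := by
  intro u hu v hv a b ha hb hab i
  have h1 := mul_le_mul_of_nonneg_left (hu i) ha
  have h2 := mul_le_mul_of_nonneg_left (hv i) hb
  rw [inner_add_right, inner_smul_right, inner_smul_right]
  nlinarith

theorem isClosed_feasible : IsClosed D.feasible := by
  have : D.feasible = ⋂ i, {w | 1 ≤ D.y i * inner ℝ (D.x i) w} := by
    ext w; simp [feasible]
  rw [this]
  exact isClosed_iInter fun i => isClosed_le (by fun_prop) (by fun_prop)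

theorem existsUnique_isMaxMargin (h : D.Separable) : ∃! w, D.IsMaxMargin w := by
  obtain ⟨w, hw, hmin⟩ := exists_norm_eq_iInf_of_complete_convex (D.feasible_nonempty h)
    D.isClosed_feasible.isComplete D.convex_feasible 0
  have hle : ∀ v ∈ D.feasible, ‖w‖ ≤ ‖v‖ := by
    intro v hv
    have h0 : (⨅ u : D.feasible, ‖(0 : EuclideanSpace ℝ (Fin d)) - u‖) ≤ ‖0 - v‖ :=
      ciInf_le ⟨0, Set.forall_mem_range.2 fun _ => norm_nonneg _⟩ (⟨v, hv⟩ : D.feasible)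
    rw [← hmin] at h0
    simpa using h0
  refine ⟨w, ⟨hw, fun v hv => by gcongr; exact hle v hv⟩, fun v hv => ?_⟩
  have hi := (norm_eq_iInf_iff_real_inner_le_zero D.convex_feasible hw).1 hmin v hv.1
  have h2 := hv.2 w hw
  have h3 : ‖v - w‖ ^ 2 = ‖v‖ ^ 2 - 2 * inner ℝ v w + ‖w‖ ^ 2 := norm_sub_sq_real v w
  have h4 : inner ℝ w v = inner ℝ v w := real_inner_comm v w
  rw [zero_sub, inner_neg_left, inner_sub_right, real_inner_self_eq_norm_sq] at hi
  have h5 : ‖v - w‖ ^ 2 ≤ 0 := by nlinarith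
  have h6 : ‖v - w‖ = 0 := by nlinarith [norm_nonneg (v - w)]
  exact sub_eq_zero.1 (norm_eq_zero.1 h6)

theorem isMaxMargin_maxMargin (h : D.Separable) : D.IsMaxMargin D.maxMargin :=
  Classical.epsilon_spec (D.existsUnique_isMaxMargin h).exists

/-- The maximum margin `φ = min_i y_i x_iᵀ ŵ / ‖ŵ‖`. -/
def margin : ℝ := ⨅ i, D.y i * inner ℝ (D.x i) D.maxMargin / ‖D.maxMargin‖

open Classical in
/-- The index set `S` of the support vectors. -/
def supportSet : Finset (Fin N) :=
  {i | D.y i * inner ℝ (D.x i) D.maxMargin / ‖D.maxMargin‖ = D.margin}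

/-- `α` consists of positive coefficients on `S` (extended by zero to all indices) with
`ŵ = ∑_{i ∈ S} α_i y_i x_i`. -/
def IsDual (α : Fin N → ℝ) : Prop :=
  (∀ i ∈ D.supportSet, 0 < α i) ∧ (∀ i ∉ D.supportSet, α i = 0) ∧
    D.maxMargin = ∑ i ∈ D.supportSet, (α i * D.y i) • D.x i

/-- Non-degeneracy of the support vectors: the positive dual coefficients exist and are unique. -/
def NonDegenerate : Prop := ∃! α, D.IsDual α

/-- The support vectors span the dataset. -/
def SupportSpans : Prop :=
  Set.finrank ℝ (D.x '' D.supportSet) = Set.finrank ℝ (Set.range D.x)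

/-- The training loss of the task that is presented at stage `t` under the cyclic order,
i.e. of task `t mod M`. -/
def stageLoss (ℓ : ℝ → ℝ) (t : ℕ) (w : EuclideanSpace ℝ (Fin d)) : ℝ :=
  ∑ i with (D.task i : ℕ) = t % M, ℓ (D.y i * inner ℝ (D.x i) w)

/-- One gradient descent step at stage `t` with learning rate `η`. -/
def gdStep (ℓ : ℝ → ℝ) (η : ℝ) (t : ℕ) (w : EuclideanSpace ℝ (Fin d)) :
    EuclideanSpace ℝ (Fin d) :=
  w - η • gradient (D.stageLoss ℓ t) w

/-- The iterate `w_0^{(t)}` at the beginning of stage `t`: `w_0^{(t+1)} = w_K^{(t)}`. -/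
def stageStart (ℓ : ℝ → ℝ) (η : ℝ) (K : ℕ) (w₀ : EuclideanSpace ℝ (Fin d)) :
    ℕ → EuclideanSpace ℝ (Fin d)
  | 0 => w₀
  | t + 1 => (D.gdStep ℓ η t)^[K] (stageStart ℓ η K w₀ t)

/-- The cyclic sequential gradient descent iterate `w_k^{(t)}`. -/
def iterate (ℓ : ℝ → ℝ) (η : ℝ) (K : ℕ) (w₀ : EuclideanSpace ℝ (Fin d)) (t k : ℕ) :
    EuclideanSpace ℝ (Fin d) :=
  (D.gdStep ℓ η t)^[k] (D.stageStart ℓ η K w₀ t)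

/-- The residual `ρ_k^{(t)}`, defined by `w_k^{(t)} = ln (K t / M) ŵ + ρ_k^{(t)}`. -/
def residual (ℓ : ℝ → ℝ) (η : ℝ) (K : ℕ) (w₀ : EuclideanSpace ℝ (Fin d)) (t k : ℕ) :
    EuclideanSpace ℝ (Fin d) :=
  D.iterate ℓ η K w₀ t k - Real.log ((K : ℝ) / M * t) • D.maxMargin

/-- The space spanned by the support vectors. -/
def supportSpan : Submodule ℝ (EuclideanSpace ℝ (Fin d)) :=
  Submodule.span ℝ (D.x '' D.supportSet)

/-- The system `η exp (-y_i x_iᵀ w) = α_i` for `i ∈ S`, `(I - P) (w - w₀) = 0`, where `P` is the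
orthogonal projection onto the span of the support vectors. -/
def ResidualSystem (η : ℝ) (α : Fin N → ℝ) (w₀ w : EuclideanSpace ℝ (Fin d)) : Prop :=
  (∀ i ∈ D.supportSet, η * Real.exp (-(D.y i * inner ℝ (D.x i) w)) = α i) ∧
    (w - w₀) - D.supportSpan.starProjection (w - w₀) = 0

end TaskData

end SeqGD

end

/-! ### Scalar inequalities and the discrete drift criterion. -/

namespace SeqGD

/-! Write `zᵢ = yᵢ xᵢ` and run all gradient steps as one sequence. Over a cycle of `K M` steps every
index acts exactly `K` times, so a cycle is a perturbed gradient step of length `η K` on the total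
loss. With `q = η K β σ²` the relative error is at most `r = q M (σ/φ) / (1 - q M)`
(`norm_cycle_sub_le`), and the learning rate bound says precisely enough for the total loss to
decrease by a multiple of the squared gradient norm. Hence the gradients at the cycle starts tend to
zero. Separability bounds `∑ᵢ |ℓ'(zᵢ·w)|` by the gradient norm, so every margin tends to infinity
(`tendsto_inner_atTop`).

There `-ℓ'(x)` is asymptotic to `exp (-x)`, and the displacement inside a cycle tends to zero. The
cycle starts `W c` therefore satisfy `W (c+1) = W c + η K ∑ᵢ exp(-zᵢ·W c) (1 + o(1)) zᵢ`
(`exists_cycle_eq`).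

Put `r c = W c - log (K c) ŵ - w̃` and `uᵢ = zᵢ·r c`. For a support vector `η K exp(-zᵢ·W c) = αᵢ
exp(-uᵢ) / c`, while `log (K c) ŵ` grows by about `∑ αᵢ zᵢ / c`. To leading order `‖r‖²` thus
changes by `-(2/c) ∑ αᵢ uᵢ (1 - exp(-uᵢ))`, whose summands are nonnegative; the other data
contribute `o(1/c)` from above. The iterates stay in `w₀` plus the support span, where the `uᵢ`
control `‖r‖`, so the drift is at most `-const · min(‖r‖², 1) / c + o(1/c)`. Since the harmonic
series diverges, `‖r‖ → 0` (`tendsto_zero_of_drift`, `tendsto_sub_log_smul`). No prior bound on `r`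
is needed.

Finally stage `t` lies in cycle `⌊t/M⌋`, and `log (K ⌊t/M⌋) - log (K t / M) → 0`. -/

theorem min_sq_one_le_two_mul (u : ℝ) : min (u ^ 2) 1 ≤ 2 * (u * (1 - Real.exp (-u))) := by
  rcases le_or_gt 0 u with hu | hu
  · have h1 : Real.exp (-u) ≤ (1 + u)⁻¹ := by
      rw [Real.exp_neg]
      exact inv_anti₀ (by linarith) (by linarith [Real.add_one_le_exp u])
    have h2 : u ^ 2 / (1 + u) ≤ u * (1 - Real.exp (-u)) := by
      calc u ^ 2 / (1 + u) = u * (1 - (1 + u)⁻¹) := by field_simp; ring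
        _ ≤ _ := by gcongr
    have h3 : min (u ^ 2) 1 ≤ 2 * (u ^ 2 / (1 + u)) := by
      rw [← mul_div_assoc, le_div_iff₀ (by linarith)]
      rcases le_total u 1 with h | h
      · nlinarith [min_le_left (u ^ 2) 1, le_min (sq_nonneg u) zero_le_one]
      · nlinarith [min_le_right (u ^ 2) 1, le_min (sq_nonneg u) zero_le_one]
    linarith
  · nlinarith [min_le_left (u ^ 2) 1, Real.add_one_le_exp (-u)]

theorem mul_exp_neg_le_one (u : ℝ) : u * Real.exp (-u) ≤ 1 := by
  have h := Real.add_one_le_exp u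
  rw [Real.exp_neg, ← div_eq_mul_inv, div_le_one (Real.exp_pos u)]
  linarith

/-- The terms multiplying the relative errors grow no faster than the drift `u (1 - exp (-u))`
itself in either direction, so small relative errors can be absorbed without bounding `u`. -/
theorem abs_mul_exp_neg_add_le (u : ℝ) :
    |u| * Real.exp (-u) + |u| + Real.exp (-u) ≤ 4 + 3 * (u * (1 - Real.exp (-u))) := by
  rcases le_or_gt 0 u with hu | hu
  · rw [abs_of_nonneg hu]
    have h1 := mul_exp_neg_le_one u
    have h2 : Real.exp (-u) ≤ 1 := Real.exp_le_one_iff.2 (by linarith)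
    nlinarith
  · rw [abs_of_neg hu]
    have h1 := Real.add_one_le_exp (-u)
    have h2 : 0 ≤ (u + 1) ^ 2 := sq_nonneg _
    rcases le_or_gt (-1) u with h | h
    · have h3 : Real.exp (-u) ≤ 3 :=
        (Real.exp_le_exp.2 (by linarith : -u ≤ 1)).trans (by linarith [Real.exp_one_lt_d9])
      nlinarith
    · nlinarith

/-- Up to a small error, the perturbed drift is half the unperturbed one. -/
theorem perturbed_drift_le {u a b c τ : ℝ} (ha : |a| ≤ τ) (hb : |b| ≤ τ) (hc : |c| ≤ τ)
    (hτ : τ ≤ 1 / 6) :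
    u * Real.exp (-u) * (1 + a) - u * (1 + b) + c * Real.exp (-u)
      ≤ -(min (u ^ 2) 1 / 4) + 4 * τ := by
  have h0 := min_sq_one_le_two_mul u
  have h1 := abs_mul_exp_neg_add_le u
  have hF : 0 ≤ u * (1 - Real.exp (-u)) := by
    linarith [le_min (sq_nonneg u) zero_le_one]
  have hτ0 : 0 ≤ τ := (abs_nonneg a).trans ha
  have hE := Real.exp_pos (-u)
  have e1 : u * Real.exp (-u) * a ≤ |u| * Real.exp (-u) * τ := by
    calc _ ≤ |u * Real.exp (-u) * a| := le_abs_self _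
      _ = |u| * Real.exp (-u) * |a| := by rw [abs_mul, abs_mul, abs_of_pos hE]
      _ ≤ _ := by gcongr
  have e2 : -(u * b) ≤ |u| * τ := by
    calc _ ≤ |u * b| := neg_le_abs _
      _ = |u| * |b| := abs_mul _ _
      _ ≤ _ := by gcongr
  have e3 : c * Real.exp (-u) ≤ τ * Real.exp (-u) := by
    have := (le_abs_self c).trans hc
    gcongr
  -- With `F = u (1 - exp (-u))` the total is at most `-F + τ (4 + 3 F)`, and `3 τ ≤ 1/2` leaves
  -- `-F/2 + 4 τ`.
  nlinarith [mul_le_mul_of_nonneg_left h1 hτ0]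

/-- Serves the non-support data: only an upper bound matters, and for very negative `u` the first
term is negative and dominates. -/
theorem mul_exp_neg_mul_add_le_two {u a c : ℝ} (ha : |a| ≤ 1 / 2) (hc : |c| ≤ 1 / 2) :
    u * Real.exp (-u) * (1 + a) + c * Real.exp (-u) ≤ 2 := by
  obtain ⟨a1, a2⟩ := abs_le.1 ha
  obtain ⟨c1, c2⟩ := abs_le.1 hc
  have hE := Real.exp_pos (-u)
  rcases le_or_gt 0 u with hu | hu
  · have h1 := mul_exp_neg_le_one u
    have h2 : Real.exp (-u) ≤ 1 := Real.exp_le_one_iff.2 (by linarith)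
    nlinarith [mul_nonneg hu hE.le]
  · have h1 : (1 + u) * Real.exp (-u) ≤ 1 := by
      have h := Real.add_one_le_exp u
      rw [Real.exp_neg, ← div_eq_mul_inv, div_le_one (Real.exp_pos u)]
      linarith
    nlinarith [mul_neg_of_neg_of_pos hu hE]

/-- A nonnegative sequence with drift `-κ min(V, 1) / c`, up to `o(1 / c)`, tends to zero. -/
theorem tendsto_zero_of_drift {V ε : ℕ → ℝ} {κ : ℝ} (hκ : 0 < κ) (hV : ∀ c, 0 ≤ V c)
    (hε : Tendsto ε atTop (𝓝 0))
    (h : ∀ᶠ c : ℕ in atTop, V (c + 1) ≤ V c + (1 / c : ℝ) * (-(κ * min (V c) 1) + ε c)) :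
    Tendsto V atTop (𝓝 0) := by
  have key : ∀ δ : ℝ, 0 < δ → δ ≤ 1 → ∀ᶠ c in atTop, V c ≤ 2 * δ := by
    intro δ hδ hδ1
    -- The first bound on `ε` preserves half of the drift while `V ≥ δ`; the second limits a step
    -- starting below `δ` to a rise of `δ`. Once below `δ`, the sequence is thus trapped below `2
    -- δ`.
    have hs : 0 < min (κ * δ / 2) δ := lt_min (by positivity) hδ
    obtain ⟨c0, hc0⟩ := eventually_atTop.1
      ((h.and (hε.eventually (gt_mem_nhds hs))).and (eventually_ge_atTop 1))
    have hdec : ∀ c ≥ c0, δ ≤ V c → V (c + 1) ≤ V c - κ * δ / 2 * (1 / c : ℝ) := by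
      intro c hc hVc
      obtain ⟨⟨h1, h2⟩, h3⟩ := hc0 c hc
      have h4 : δ ≤ min (V c) 1 := le_min hVc hδ1
      have h5 := h2.le.trans (min_le_left _ _)
      have h6 : (0 : ℝ) < 1 / c := by have : (0 : ℝ) < c := by exact_mod_cast h3
                                      positivity
      nlinarith [mul_le_mul_of_nonneg_left h4 hκ.le]
    -- Otherwise `V` would fall by a constant multiple of the harmonic sums, hence of the logarithm,
    -- and become negative.
    have hex : ∃ c ≥ c0, V c < δ := by
      by_contra! hcon
      have hmono : ∀ n : ℕ, V (c0 + n) + κ * δ / 2 * Real.log ((c0 + n : ℕ) : ℝ)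
          ≤ V c0 + κ * δ / 2 * Real.log c0 := by
        intro n
        induction n with
        | zero => simp
        | succ n ih =>
          refine le_trans ?_ ih
          have h1 := hdec (c0 + n) (by omega) (hcon _ (by omega))
          have h3 : (0 : ℝ) < ((c0 + n : ℕ) : ℝ) := by
            exact_mod_cast (hc0 (c0 + n) (by omega)).2
          have h4 : Real.log ((c0 + (n + 1) : ℕ) : ℝ)
              ≤ Real.log ((c0 + n : ℕ) : ℝ) + 1 / ((c0 + n : ℕ) : ℝ) := by
            have h5 := Real.log_le_sub_one_of_pos
              (x := ((c0 + n : ℕ) + 1 : ℝ) / ((c0 + n : ℕ) : ℝ)) (by positivity)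
            rw [Real.log_div (by positivity) h3.ne', add_div, div_self h3.ne'] at h5
            have h6 : ((c0 + (n + 1) : ℕ) : ℝ) = ((c0 + n : ℕ) : ℝ) + 1 := by push_cast; ring
            rw [h6]
            linarith
          have h7 : 0 ≤ κ * δ / 2 := by positivity
          rw [← add_assoc c0 n 1] at *
          nlinarith [mul_le_mul_of_nonneg_left h4 h7]
      have hlim : Tendsto (fun n : ℕ => κ * δ / 2 * Real.log ((c0 + n : ℕ) : ℝ)) atTop atTop := by
        refine Tendsto.const_mul_atTop (by positivity) (Real.tendsto_log_atTop.comp ?_)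
        refine tendsto_natCast_atTop_atTop.comp ?_
        simpa [add_comm] using tendsto_add_atTop_nat c0
      obtain ⟨n, hn⟩ := (hlim.eventually_gt_atTop (V c0 + κ * δ / 2 * Real.log c0)).exists
      linarith [hmono n, hV (c0 + n)]
    obtain ⟨c1, hc1, hlt⟩ := hex
    refine eventually_atTop.2 ⟨c1, fun c hc => ?_⟩
    induction c, hc using Nat.le_induction with
    | base => linarith
    | succ c hc ih =>
      have hcc := hc1.trans hc
      have h3 : (1 : ℝ) ≤ c := by exact_mod_cast (hc0 c hcc).2
      rcases le_or_gt δ (V c) with hVc | hVc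
      · have := hdec c hcc hVc
        have : 0 ≤ κ * δ / 2 * (1 / c : ℝ) := by positivity
        linarith
      · obtain ⟨⟨h1, h2⟩, -⟩ := hc0 c hcc
        have h5 := h2.le.trans (min_le_right _ _)
        have h6 : 0 ≤ κ * min (V c) 1 := mul_nonneg hκ.le (le_min (hV c) zero_le_one)
        have h7 : (1 / c : ℝ) ≤ 1 := by rw [div_le_one (by linarith)]; exact h3
        have h8 : (1 / c : ℝ) * (-(κ * min (V c) 1) + ε c) ≤ 1 * δ := by
          calc _ ≤ (1 / c : ℝ) * δ := by gcongr; linarith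
            _ ≤ _ := by gcongr
        linarith
  rw [Metric.tendsto_atTop']
  intro e he
  obtain ⟨n, hn⟩ := eventually_atTop.1 (key (min (e / 3) 1) (by positivity) (min_le_right _ _))
  refine ⟨n, fun c hc => ?_⟩
  rw [Real.dist_eq, sub_zero, abs_of_nonneg (hV c)]
  linarith [hn c hc.le, min_le_left (e / 3) 1]

end SeqGD

/-! ### Lyapunov argument for the exponential cycle recursion. -/

namespace SeqGD

theorem min_mul_one_le_sum_min {ι : Type*} (S : Finset ι) (u : ι → ℝ) :
    min (∑ i ∈ S, u i ^ 2) 1 ≤ ∑ i ∈ S, min (u i ^ 2) 1 := by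
  by_cases h : ∃ i ∈ S, 1 ≤ u i ^ 2
  · obtain ⟨i, hi, h1⟩ := h
    refine (min_le_right _ _).trans ?_
    calc (1 : ℝ) = min (u i ^ 2) 1 := (min_eq_right h1).symm
      _ ≤ _ := Finset.single_le_sum (f := fun i => min (u i ^ 2) 1)
        (fun j _ => le_min (sq_nonneg (u j)) zero_le_one) hi
  · push Not at h
    refine (min_le_left _ _).trans (Finset.sum_le_sum fun i hi => ?_)
    rw [min_eq_left (h i hi).le]

theorem norm_sum_smul_sq_le {E ι : Type*} [NormedAddCommGroup E] [NormedSpace ℝ E] [Fintype ι]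
    (z : ι → E) (a : ι → ℝ) : ‖∑ i, a i • z i‖ ^ 2 ≤ (∑ i, ‖z i‖ ^ 2) * ∑ i, a i ^ 2 := by
  have h1 : ‖∑ i, a i • z i‖ ≤ ∑ i, ‖z i‖ * |a i| := by
    refine (norm_sum_le _ _).trans (Finset.sum_le_sum fun i _ => ?_)
    rw [norm_smul, Real.norm_eq_abs, mul_comm]
  calc ‖∑ i, a i • z i‖ ^ 2 ≤ (∑ i, ‖z i‖ * |a i|) ^ 2 := by gcongr
    _ ≤ (∑ i, ‖z i‖ ^ 2) * ∑ i, |a i| ^ 2 := Finset.sum_mul_sq_le_sq_mul_sq _ _ _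
    _ = _ := by simp_rw [sq_abs]

/-- If a sequence moves by `ηK ∑ exp(-zᵢ·W) (1 + o(1)) zᵢ` and all `zᵢ·W` tend to infinity, then it
follows `log (K c) ŵ + w̃`. -/
theorem tendsto_sub_log_smul {E ι : Type*} [NormedAddCommGroup E] [InnerProductSpace ℝ E]
    [Fintype ι] [DecidableEq ι] {W : ℕ → E} {z : ι → E} {S : Finset ι} {α : ι → ℝ} {η K κ : ℝ}
    (hη : 0 < η) (hK : 0 < K) {what wt : E} (hα : ∀ i ∈ S, 0 < α i)
    (hwhat : what = ∑ i ∈ S, α i • z i) (hS : ∀ i ∈ S, inner ℝ (z i) what = (1 : ℝ))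
    (hSc : ∀ i ∉ S, 1 < (inner ℝ (z i) what : ℝ))
    (hwt : ∀ i ∈ S, η * Real.exp (-inner ℝ (z i) wt) = α i)
    {ε : ℕ → ι → ℝ} (hε : ∀ i, Tendsto (fun c => ε c i) atTop (𝓝 0))
    (hW : ∀ c, W (c + 1) =
      W c + (η * K) • ∑ i, (Real.exp (-inner ℝ (z i) (W c)) * (1 + ε c i)) • z i)
    (hW0 : ∀ i, Tendsto (fun c => Real.exp (-inner ℝ (z i) (W c))) atTop (𝓝 0))
    (hκ : 0 < κ)
    (hcoer : ∀ c : ℕ, κ * ‖W c - Real.log (K * c) • what - wt‖ ^ 2 ≤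
      ∑ i ∈ S, (inner ℝ (z i) (W c - Real.log (K * c) • what - wt) : ℝ) ^ 2) :
    Tendsto (fun c : ℕ => W c - Real.log (K * c) • what) atTop (𝓝 wt) := by
  set r : ℕ → E := fun c => W c - Real.log (K * c) • what - wt with hr
  set a : ℕ → ι → ℝ := fun c i => Real.exp (-inner ℝ (z i) (W c)) with ha
  set u : ℕ → ι → ℝ := fun c i => inner ℝ (z i) (r c) with hu
  -- Relative error of the logarithmic increment: `log (K (c+1)) - log (K c) = (1 + s c) / c`.
  set s : ℕ → ℝ := fun c => c * Real.log (1 + 1 / c) - 1 with hs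
  set B : ℝ := ∑ i, ‖z i‖ ^ 2 with hB
  -- The second-order term is quadratic in `a`; one factor `a c i → 0` goes into `e`, so that it
  -- becomes a relative error of the first-order term.
  set e : ℕ → ι → ℝ := fun c i => η * K * B * a c i * (1 + ε c i) ^ 2 with he
  -- `g c i` is `c` times the exponential weight at zero residual: equal to `α i` on `S`, and of
  -- order `c ^ (1 - θ)` with `θ = zᵢ·ŵ > 1` off `S`.
  set g : ℕ → ι → ℝ := fun c i =>
    η * K * c * Real.exp (-(Real.log (K * c) * inner ℝ (z i) what) - inner ℝ (z i) wt) with hg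
  have hs0 : Tendsto s atTop (𝓝 0) := by
    have := (Real.tendsto_mul_log_one_add_div_atTop 1).comp tendsto_natCast_atTop_atTop
    simpa [hs] using this.sub_const 1
  have he0 : ∀ i, Tendsto (fun c => e c i) atTop (𝓝 0) := by
    intro i
    have := (((hW0 i).const_mul (η * K * B))).mul (((hε i).const_add 1).pow 2)
    simpa [he] using this
  have hg0 : ∀ i ∉ S, Tendsto (fun c => g c i) atTop (𝓝 0) := by
    intro i hi
    set θ : ℝ := inner ℝ (z i) what with hθ
    have h1 : Tendsto (fun c : ℕ => Real.log (K * c) * (θ - 1)) atTop atTop := by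
      refine Tendsto.atTop_mul_const (by linarith [hSc i hi]) (Real.tendsto_log_atTop.comp ?_)
      exact Tendsto.const_mul_atTop hK tendsto_natCast_atTop_atTop
    have h2 := ((Real.tendsto_exp_neg_atTop_nhds_zero.comp h1).const_mul
      (η * Real.exp (-inner ℝ (z i) wt)))
    rw [mul_zero] at h2
    refine h2.congr' ?_
    filter_upwards [eventually_gt_atTop 0] with c hc
    have hc' : (0 : ℝ) < K * c := by positivity
    have h3 : K * c = Real.exp (Real.log (K * c)) := (Real.exp_log hc').symm
    simp only [hg, Function.comp_apply]
    rw [mul_assoc η K, ← hθ]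
    conv_rhs => rw [h3, Real.log_exp, mul_assoc, ← Real.exp_add]
    rw [mul_assoc, ← Real.exp_add]
    congr 2
    ring
  obtain ⟨α0, hα0, hαle⟩ : ∃ α0 > 0, ∀ i ∈ S, α0 ≤ α i := by
    rcases S.eq_empty_or_nonempty with hem | hne
    · exact ⟨1, one_pos, by simp [hem]⟩
    · obtain ⟨i, hi, hmin⟩ := S.exists_min_image α hne
      exact ⟨α i, hα i hi, hmin⟩
  set τ : ℕ → ι → ℝ := fun c i => |ε c i| + |s c| + |e c i| with hτ
  have hτ0 : ∀ i, Tendsto (fun c => τ c i) atTop (𝓝 0) := by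
    intro i
    simpa [hτ] using ((hε i).abs.add hs0.abs).add (he0 i).abs
  -- The constants are `2 α i` times the `4 τ` of `perturbed_drift_le`, and `2 g` times the bound
  -- `2` of `mul_exp_neg_mul_add_le_two`. The last summand is the squared increment of `log (K c)
  -- ŵ`.
  set Err : ℕ → ℝ := fun c => ∑ i, (if i ∈ S then 8 * α i * τ c i else 4 * g c i)
    + 2 * (1 / (c : ℝ)) * (1 + s c) ^ 2 * ‖what‖ ^ 2 with hErr
  have hErr0 : Tendsto Err atTop (𝓝 0) := by
    have h1 : Tendsto (fun c => ∑ i, (if i ∈ S then 8 * α i * τ c i else 4 * g c i)) atTop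
        (𝓝 (∑ i : ι, (0 : ℝ))) := by
      refine tendsto_finsetSum _ fun i _ => ?_
      by_cases hi : i ∈ S
      · simpa [hi] using (hτ0 i).const_mul (8 * α i)
      · simpa [hi] using (hg0 i hi).const_mul 4
    have h2 : Tendsto (fun c : ℕ => 2 * (1 / (c : ℝ)) * (1 + s c) ^ 2 * ‖what‖ ^ 2) atTop
        (𝓝 (2 * 0 * (1 + 0) ^ 2 * ‖what‖ ^ 2)) :=
      ((tendsto_one_div_atTop_nhds_zero_nat.const_mul 2).mul ((hs0.const_add 1).pow 2)).mul_const _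
    simpa [hErr] using h1.add h2
  have hWr : ∀ c, W c = r c + Real.log (K * c) • what + wt := fun c => by simp only [hr]; abel
  have hstep : ∀ᶠ c : ℕ in atTop, ‖r (c + 1)‖ ^ 2 ≤ ‖r c‖ ^ 2
      + (1 / c : ℝ) * (-(α0 * min κ 1 / 2 * min (‖r c‖ ^ 2) 1) + Err c) := by
    have hsmall : ∀ᶠ c in atTop, ∀ i, τ c i ≤ 1 / 6 :=
      eventually_all.2 fun i => ((hτ0 i).eventually (gt_mem_nhds (by norm_num))).mono
        fun _ h => h.le
    filter_upwards [hsmall, eventually_gt_atTop 0] with c hsm hc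
    have hc' : (0 : ℝ) < c := by exact_mod_cast hc
    have hKc : 0 < K * c := by positivity
    have haexp : ∀ i, a c i = Real.exp (-(Real.log (K * c) * inner ℝ (z i) what)
        - inner ℝ (z i) wt) * Real.exp (-u c i) := by
      intro i
      simp only [ha]
      rw [hWr c, inner_add_right, inner_add_right, inner_smul_right, ← Real.exp_add]
      congr 1
      simp only [hu]; ring
    have hagc : ∀ i, η * K * a c i = (1 / c) * (g c i * Real.exp (-u c i)) := by
      intro i; rw [haexp]; simp only [hg]; field_simp
    have hgS : ∀ i ∈ S, g c i = α i := by
      intro i hi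
      simp only [hg]
      rw [hS i hi, mul_one, sub_eq_add_neg, Real.exp_add, Real.exp_neg (Real.log _),
        Real.exp_log hKc, ← hwt i hi]
      field_simp
    set X : E := ∑ i, (a c i * (1 + ε c i)) • z i with hX
    have hD : r (c + 1) = r c + ((η * K) • X - ((1 / c) * (1 + s c)) • what) := by
      have h1 : Real.log (K * ((c + 1 : ℕ) : ℝ)) = Real.log (K * c) + (1 / c) * (1 + s c) := by
        have h2 : K * ((c + 1 : ℕ) : ℝ) = (K * c) * (1 + 1 / c) := by push_cast; field_simp
        rw [h2, Real.log_mul hKc.ne' (by positivity)]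
        simp only [hs]; field_simp; ring
      simp only [hr]
      rw [h1, hW c, add_smul]
      simp only [hX, ha]
      abel
    have hX2 : ‖X‖ ^ 2 ≤ B * ∑ i, (a c i * (1 + ε c i)) ^ 2 := norm_sum_smul_sq_le z _
    have hnorm : ‖(η * K) • X - ((1 / c) * (1 + s c)) • what‖ ^ 2
        ≤ 2 * (η * K) ^ 2 * ‖X‖ ^ 2 + 2 * ((1 / c) * (1 + s c)) ^ 2 * ‖what‖ ^ 2 := by
      have h1 := norm_sub_le ((η * K) • X) (((1 / c : ℝ) * (1 + s c)) • what)
      rw [norm_smul, norm_smul, Real.norm_eq_abs, Real.norm_eq_abs] at h1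
      calc _ ≤ (|η * K| * ‖X‖ + |1 / c * (1 + s c)| * ‖what‖) ^ 2 := by gcongr
        _ ≤ 2 * ((|η * K| * ‖X‖) ^ 2 + (|1 / c * (1 + s c)| * ‖what‖) ^ 2) := add_sq_le
        _ = _ := by rw [mul_pow, mul_pow, sq_abs, sq_abs]; ring
    have hinnX : inner ℝ (r c) X = ∑ i, a c i * (1 + ε c i) * u c i := by
      rw [hX, inner_sum]
      refine Finset.sum_congr rfl fun i _ => ?_
      rw [inner_smul_right, real_inner_comm]
    have hinnw : inner ℝ (r c) what = ∑ i, if i ∈ S then α i * u c i else 0 := by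
      rw [hwhat, inner_sum, Finset.sum_ite_mem, Finset.univ_inter]
      refine Finset.sum_congr rfl fun i _ => ?_
      rw [inner_smul_right, real_inner_comm]
    have hmain : ‖r (c + 1)‖ ^ 2 ≤ ‖r c‖ ^ 2 + (1 / c) * (∑ i,
        2 * (g c i * (u c i * Real.exp (-u c i) * (1 + ε c i) + e c i * Real.exp (-u c i))
          - (if i ∈ S then α i * u c i else 0) * (1 + s c))
          + 2 * (1 / (c : ℝ)) * (1 + s c) ^ 2 * ‖what‖ ^ 2) := by
      rw [hD, norm_add_sq_real, inner_sub_right, inner_smul_right, inner_smul_right, hinnX, hinnw]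
      have h1 : 2 * (η * K) ^ 2 * ‖X‖ ^ 2
          ≤ ∑ i, 2 * ((1 / c) * (g c i * Real.exp (-u c i))) * e c i := by
        calc 2 * (η * K) ^ 2 * ‖X‖ ^ 2
            ≤ 2 * (η * K) ^ 2 * (B * ∑ i, (a c i * (1 + ε c i)) ^ 2) := by gcongr
          _ = ∑ i, 2 * (η * K * a c i) * e c i := by
              simp only [he, Finset.mul_sum]
              exact Finset.sum_congr rfl fun i _ => by ring
          _ = _ := Finset.sum_congr rfl fun i _ => by rw [hagc]
      have h2 : 2 * (η * K * ∑ i, a c i * (1 + ε c i) * u c i)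
          = ∑ i, 2 * ((1 / c) * (g c i * Real.exp (-u c i))) * (1 + ε c i) * u c i := by
        simp only [← hagc, Finset.mul_sum]
        exact Finset.sum_congr rfl fun i _ => by ring
      have h3 : (1 / c) * (∑ i,
        2 * (g c i * (u c i * Real.exp (-u c i) * (1 + ε c i) + e c i * Real.exp (-u c i))
          - (if i ∈ S then α i * u c i else 0) * (1 + s c))
          + 2 * (1 / (c : ℝ)) * (1 + s c) ^ 2 * ‖what‖ ^ 2)
          = ∑ i, 2 * ((1 / c) * (g c i * Real.exp (-u c i))) * (1 + ε c i) * u c i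
          + ∑ i, 2 * ((1 / c) * (g c i * Real.exp (-u c i))) * e c i
          - 2 * ((1 / c) * (1 + s c) * ∑ i, if i ∈ S then α i * u c i else 0)
          + 2 * ((1 / c) * (1 + s c)) ^ 2 * ‖what‖ ^ 2 := by
        rw [mul_add, Finset.mul_sum, Finset.mul_sum, Finset.mul_sum, ← Finset.sum_add_distrib,
          ← Finset.sum_sub_distrib]
        congr 1
        · exact Finset.sum_congr rfl fun i _ => by ring
        · ring
      linarith
    refine hmain.trans ?_
    gcongr ‖r c‖ ^ 2 + 1 / (c : ℝ) * ?_
    have hterm : ∀ i,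
        2 * (g c i * (u c i * Real.exp (-u c i) * (1 + ε c i) + e c i * Real.exp (-u c i))
          - (if i ∈ S then α i * u c i else 0) * (1 + s c))
        ≤ (if i ∈ S then -(α0 / 2 * min (u c i ^ 2) 1) else 0)
          + (if i ∈ S then 8 * α i * τ c i else 4 * g c i) := by
      intro i
      have t1 : |ε c i| ≤ τ c i := by simp only [hτ]; linarith [abs_nonneg (s c), abs_nonneg (e c i)]
      have t2 : |s c| ≤ τ c i := by simp only [hτ]; linarith [abs_nonneg (ε c i), abs_nonneg (e c i)]
      have t3 : |e c i| ≤ τ c i := by simp only [hτ]; linarith [abs_nonneg (s c), abs_nonneg (ε c i)]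
      by_cases hi : i ∈ S
      · simp only [hi, if_true]
        rw [hgS i hi]
        have h1 := perturbed_drift_le (u := u c i) t1 t2 t3 (hsm i)
        have h2 := mul_le_mul_of_nonneg_left h1 (hα i hi).le
        have h3 : 0 ≤ min (u c i ^ 2) 1 := le_min (sq_nonneg _) zero_le_one
        nlinarith [mul_le_mul_of_nonneg_right (hαle i hi) h3]
      · simp only [hi, if_false]
        have hgn : 0 ≤ g c i := by simp only [hg]; positivity
        have h1 := mul_exp_neg_mul_add_le_two (u := u c i) (a := ε c i) (c := e c i)
          (by linarith [hsm i]) (by linarith [hsm i])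
        nlinarith [mul_le_mul_of_nonneg_left h1 hgn]
    have hsum := Finset.sum_le_sum fun i (_ : i ∈ Finset.univ) => hterm i
    rw [Finset.sum_add_distrib, Finset.sum_ite_mem, Finset.univ_inter] at hsum
    -- Coercivity turns the support margins into `‖r c‖`; capping `κ` at `1` makes it compatible
    -- with the truncation at `1`.
    have hneg : ∑ i ∈ S, -(α0 / 2 * min (u c i ^ 2) 1)
        ≤ -(α0 * min κ 1 / 2 * min (‖r c‖ ^ 2) 1) := by
      rw [Finset.sum_neg_distrib, ← Finset.mul_sum]
      have h1 := min_mul_one_le_sum_min S (u c)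
      have h2 : min κ 1 * min (‖r c‖ ^ 2) 1 ≤ min (∑ i ∈ S, u c i ^ 2) 1 := by
        have m0 : 0 ≤ min (‖r c‖ ^ 2) 1 := le_min (sq_nonneg _) zero_le_one
        have m1 : 0 ≤ min κ 1 := le_min hκ.le zero_le_one
        refine le_min ((le_trans ?_ (hcoer c))) ?_
        · exact mul_le_mul (min_le_left _ _) (min_le_left _ _) m0 hκ.le
        · exact mul_le_one₀ (min_le_right _ _) m0 (min_le_right _ _)
      nlinarith [mul_le_mul_of_nonneg_left (h2.trans h1) hα0.le]
    simp only [hErr]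
    linarith
  have hV := tendsto_zero_of_drift (V := fun c => ‖r c‖ ^ 2)
    (κ := α0 * min κ 1 / 2) (by positivity) (fun c => sq_nonneg _) hErr0 hstep
  have hr0 : Tendsto r atTop (𝓝 0) := by
    rw [tendsto_zero_iff_norm_tendsto_zero]
    simpa [Real.sqrt_sq] using hV.sqrt
  simpa [hr] using hr0.add_const wt

end SeqGD

/-! ### Incremental descent: cycles as perturbed full gradient steps. -/

namespace SeqGD

/-- Incremental gradient descent `uₙ₊₁ = uₙ + η ∑ bₙᵢ h(zᵢ·uₙ) zᵢ`, in which every index has total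
weight `K` in each cycle of `K M` steps, for a `β`-Lipschitz positive `h`, linearly separable data
`z` and a small learning rate `η`. -/
structure IncrementalDescent {E ι : Type*} [NormedAddCommGroup E] [InnerProductSpace ℝ E]
    [Fintype ι] (z : ι → E) (h : ℝ → ℝ) (β σ φ η : ℝ) (K M : ℕ) (b : ℕ → ι → ℝ)
    (u : ℕ → E) : Prop where
  step : ∀ n, u (n + 1) = u n + η • ∑ i, (b n i * h (inner ℝ (z i) (u n))) • z i
  weight_nonneg : ∀ n i, 0 ≤ b n i
  weight_le_one : ∀ n i, b n i ≤ 1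
  sum_weight : ∀ c i, ∑ j ∈ Finset.range (K * M), b (c * (K * M) + j) i = K
  pos : ∀ x, 0 < h x
  lipschitz : ∀ x y, |h x - h y| ≤ β * |x - y|
  β_pos : 0 < β
  σ_pos : 0 < σ
  φ_pos : 0 < φ
  η_pos : 0 < η
  one_le_K : 1 ≤ K
  one_le_M : 1 ≤ M
  norm_sum_le : ∀ a : ι → ℝ, ‖∑ i, a i • z i‖ ≤ σ * √(∑ i, a i ^ 2)
  separable : ∃ v : E, ‖v‖ = 1 ∧ ∀ i, φ ≤ inner ℝ (z i) v
  nonempty : Nonempty ι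
  rate : 2 * σ * (η * K * β * σ ^ 2) * (M * φ + σ) < φ ^ 2

theorem sqrt_sum_sq_le_sum {ι : Type*} (s : Finset ι) (a : ι → ℝ) (ha : ∀ i ∈ s, 0 ≤ a i) :
    √(∑ i ∈ s, a i ^ 2) ≤ ∑ i ∈ s, a i := by
  rw [Real.sqrt_le_left (Finset.sum_nonneg ha)]
  exact Finset.sum_sq_le_sq_sum_of_nonneg ha

/-- The constants of the cycle analysis: the relative error `r` of a cycle is small enough for
descent. -/
theorem rate_bounds {σ φ q M : ℝ} (hφ : 0 < φ) (hφσ : φ ≤ σ) (hM : 1 ≤ M) (hq : 0 < q)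
    (h : 2 * σ * q * (M * φ + σ) < φ ^ 2) :
    q * M < 1 ∧ q * (1 + q * M * (σ / φ) / (1 - q * M)) ^ 2
      < 1 - q * M * (σ / φ) / (1 - q * M) := by
  have hσ : 0 < σ := hφ.trans_le hφσ
  -- Discard the term `2 σ² q` from the rate condition and cancel one `φ`.
  have hx : 2 * σ * (q * M) < φ := by
    have h0 : 0 < σ * q * σ := by positivity
    have h1 : 2 * σ * (q * M) * φ < φ * φ := by nlinarith
    exact lt_of_mul_lt_mul_right h1 hφ.le
  have hqM : q * M < 1 := by
    have : σ * (2 * (q * M)) < σ * 1 := by linarith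
    have := lt_of_mul_lt_mul_left this hσ.le
    have : 0 < q * M := by positivity
    linarith
  refine ⟨hqM, ?_⟩
  set r := q * M * (σ / φ) / (1 - q * M) with hr
  have h1x : 0 < 1 - q * M := by linarith
  have hB : 0 < M * φ + 2 * σ := by positivity
  have hr0 : 0 ≤ r := by positivity
  -- Insert the largest admissible `q` into `r` and use `φ ≤ σ` to simplify the denominator.
  have hr1 : r ≤ M * φ / (M * φ + 2 * σ) := by
    rw [hr, ← mul_div_assoc, div_div, div_le_div_iff₀ (by positivity) hB]
    have h2 : M * (2 * σ * q * (M * φ + σ)) ≤ M * φ ^ 2 := by gcongr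
    have h3 : q * M * M * φ * φ ≤ q * M * M * φ * σ := by gcongr
    nlinarith
  have hr2 : 2 * σ / (M * φ + 2 * σ) ≤ 1 - r := by
    have : 2 * σ / (M * φ + 2 * σ) = 1 - M * φ / (M * φ + 2 * σ) := by field_simp; ring
    linarith
  have hr3 : 1 + r ≤ 2 * (M * φ + σ) / (M * φ + 2 * σ) := by
    have : 2 * (M * φ + σ) / (M * φ + 2 * σ) = 1 + M * φ / (M * φ + 2 * σ) := by field_simp; ring
    linarith
  refine lt_of_lt_of_le ?_ hr2
  calc q * (1 + r) ^ 2 ≤ q * (2 * (M * φ + σ) / (M * φ + 2 * σ)) ^ 2 := by gcongr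
    _ = (2 * σ * q * (M * φ + σ)) * (2 * (M * φ + σ)) / (σ * (M * φ + 2 * σ) ^ 2) := by
      field_simp
    _ < φ ^ 2 * (2 * (M * φ + σ)) / (σ * (M * φ + 2 * σ) ^ 2) := by gcongr
    _ ≤ σ ^ 2 * (2 * (M * φ + 2 * σ)) / (σ * (M * φ + 2 * σ) ^ 2) := by
      gcongr
      linarith
    _ = 2 * σ / (M * φ + 2 * σ) := by field_simp

/-- A weak form of the quadratic upper bound for smooth functions. -/
theorem le_add_deriv_mul_add_sq {ℓ : ℝ → ℝ} {β : ℝ} (hd : Differentiable ℝ ℓ)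
    (hs : ∀ u v, |deriv ℓ u - deriv ℓ v| ≤ β * |u - v|) (hβ : 0 ≤ β) (a b : ℝ) :
    ℓ b ≤ ℓ a + deriv ℓ a * (b - a) + β * (b - a) ^ 2 := by
  -- The mean value inequality for `ℓ x - ℓ'(a) x` on the segment gives the constant `β` instead of
  -- `β / 2`.
  have h1 := (convex_uIcc a b).norm_image_sub_le_of_norm_hasDerivWithin_le
    (f := fun x => ℓ x - deriv ℓ a * x) (f' := fun x => deriv ℓ x - deriv ℓ a)
    (C := β * |b - a|) (x := a) (y := b)
    (fun x _ => by
      have h := (hd x).hasDerivAt.fun_sub ((hasDerivAt_id' x).const_mul (deriv ℓ a))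
      rw [mul_one] at h
      exact h.hasDerivWithinAt)
    (fun x hx => by
      rw [Real.norm_eq_abs]
      refine (hs x a).trans ?_
      exact mul_le_mul_of_nonneg_left (Set.abs_sub_left_of_mem_uIcc hx) hβ) Set.left_mem_uIcc Set.right_mem_uIcc
  rw [Real.norm_eq_abs, Real.norm_eq_abs, mul_assoc, abs_mul_abs_self] at h1
  have h2 := (le_abs_self _).trans h1
  nlinarith

namespace IncrementalDescent

variable {E ι : Type*} [NormedAddCommGroup E] [InnerProductSpace ℝ E] [Fintype ι] {z : ι → E}
  {h : ℝ → ℝ} {β σ φ η : ℝ} {K M : ℕ} {b : ℕ → ι → ℝ} {u : ℕ → E}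

/-- The adjoint has the same norm: with `aᵢ = zᵢ·w`, the sum of squares equals `(∑ aᵢ zᵢ)·w`, and
one factor of the square root cancels. -/
theorem sqrt_sum_inner_sq_le (H : IncrementalDescent z h β σ φ η K M b u) (w : E) :
    √(∑ i, (inner ℝ (z i) w : ℝ) ^ 2) ≤ σ * ‖w‖ := by
  set a : ι → ℝ := fun i => inner ℝ (z i) w with ha
  have h1 : ∑ i, a i ^ 2 = inner ℝ (∑ i, a i • z i) w := by
    rw [sum_inner]
    exact Finset.sum_congr rfl fun i _ => by rw [real_inner_smul_left, sq]
  have h2 : ∑ i, a i ^ 2 ≤ σ * √(∑ i, a i ^ 2) * ‖w‖ := by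
    conv_lhs => rw [h1]
    exact (real_inner_le_norm _ _).trans (by gcongr; exact H.norm_sum_le a)
  rcases (Real.sqrt_nonneg (∑ i, a i ^ 2)).eq_or_lt with h0 | h0
  · rw [← h0]; exact mul_nonneg H.σ_pos.le (norm_nonneg _)
  · have h3 : √(∑ i, a i ^ 2) * √(∑ i, a i ^ 2) = ∑ i, a i ^ 2 :=
      Real.mul_self_sqrt (Finset.sum_nonneg fun i _ => sq_nonneg _)
    refine le_of_mul_le_mul_right ?_ h0
    linarith

theorem margin_le (H : IncrementalDescent z h β σ φ η K M b u) : φ ≤ σ := by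
  obtain ⟨v, hv, hz⟩ := H.separable
  obtain ⟨i⟩ := H.nonempty
  have h1 := H.sqrt_sum_inner_sq_le v
  rw [hv, mul_one] at h1
  refine (hz i).trans (le_trans ?_ h1)
  refine Real.le_sqrt_of_sq_le ?_
  exact Finset.single_le_sum (f := fun i => (inner ℝ (z i) v : ℝ) ^ 2)
    (fun j _ => sq_nonneg _) (Finset.mem_univ i)

/-- The (negated) partial gradients are Lipschitz. -/
theorem norm_sum_sub_le (H : IncrementalDescent z h β σ φ η K M b u) (n : ℕ) (w w' : E) :
    ‖∑ i, (b n i * (h (inner ℝ (z i) w) - h (inner ℝ (z i) w'))) • z i‖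
      ≤ β * σ ^ 2 * ‖w - w'‖ := by
  refine (H.norm_sum_le _).trans ?_
  have h1 : √(∑ i, (b n i * (h (inner ℝ (z i) w) - h (inner ℝ (z i) w'))) ^ 2)
      ≤ β * √(∑ i, (inner ℝ (z i) (w - w') : ℝ) ^ 2) := by
    rw [← Real.sqrt_sq H.β_pos.le, ← Real.sqrt_mul (sq_nonneg β), Finset.mul_sum]
    refine Real.sqrt_le_sqrt (Finset.sum_le_sum fun i _ => ?_)
    rw [← mul_pow, sq_le_sq, abs_mul, abs_mul, abs_of_pos H.β_pos, inner_sub_right,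
      abs_of_nonneg (H.weight_nonneg n i)]
    calc _ ≤ 1 * (β * |inner ℝ (z i) w - inner ℝ (z i) w'|) := by
          gcongr
          · exact H.weight_le_one n i
          · exact H.lipschitz _ _
      _ = _ := one_mul _
  have h2 := H.sqrt_sum_inner_sq_le (w - w')
  have := H.β_pos
  have := H.σ_pos
  calc _ ≤ σ * (β * (σ * ‖w - w'‖)) := by gcongr; exact h1.trans (by gcongr)
    _ = _ := by ring

theorem norm_sum_weight_le (H : IncrementalDescent z h β σ φ η K M b u) (n : ℕ) (w : E) :
    ‖∑ i, (b n i * h (inner ℝ (z i) w)) • z i‖ ≤ σ * ∑ i, b n i * h (inner ℝ (z i) w) := by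
  refine (H.norm_sum_le _).trans ?_
  have := H.σ_pos
  gcongr
  exact sqrt_sum_sq_le_sum _ _ fun i _ => mul_nonneg (H.weight_nonneg n i) (H.pos _).le

/-- Pairing with the separating unit vector excludes cancellation between the positive multiples of
the `zᵢ`. This is how a small gradient forces every single derivative to be small. -/
theorem margin_mul_sum_le (H : IncrementalDescent z h β σ φ η K M b u) (w : E) :
    φ * ∑ i, h (inner ℝ (z i) w) ≤ ‖∑ i, h (inner ℝ (z i) w) • z i‖ := by
  obtain ⟨v, hv, hz⟩ := H.separable
  have h1 := real_inner_le_norm (∑ i, h (inner ℝ (z i) w) • z i) v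
  rw [hv, mul_one, sum_inner] at h1
  refine le_trans ?_ h1
  rw [Finset.mul_sum]
  refine Finset.sum_le_sum fun i _ => ?_
  rw [real_inner_smul_left, mul_comm]
  exact mul_le_mul_of_nonneg_left (hz i) (H.pos _).le

theorem rate_bounds (H : IncrementalDescent z h β σ φ η K M b u) :
    η * K * β * σ ^ 2 * M < 1 ∧
      η * K * β * σ ^ 2 * (1 + η * K * β * σ ^ 2 * M * (σ / φ) / (1 - η * K * β * σ ^ 2 * M)) ^ 2
        < 1 - η * K * β * σ ^ 2 * M * (σ / φ) / (1 - η * K * β * σ ^ 2 * M) := by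
  have hK : (0 : ℝ) < K := by exact_mod_cast H.one_le_K
  have := H.η_pos
  have := H.β_pos
  have := H.σ_pos
  exact SeqGD.rate_bounds H.φ_pos H.margin_le (by exact_mod_cast H.one_le_M) (by positivity) H.rate

/-- Within a cycle the iterates stay close to the start of the cycle. -/
theorem norm_sub_start_le (H : IncrementalDescent z h β σ φ η K M b u) (c : ℕ) {j : ℕ}
    (hj : j ≤ K * M) :
    ‖u (c * (K * M) + j) - u (c * (K * M))‖
      ≤ η * K * σ * (∑ i, h (inner ℝ (z i) (u (c * (K * M))))) / (1 - η * K * β * σ ^ 2 * M) := by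
  set n := c * (K * M) with hn
  set W := u n with hW
  set G := ∑ i, h (inner ℝ (z i) W) with hG
  -- `R` solves `R = η K σ G + q M R` with `q = η K β σ²`: the steps with derivatives frozen at the
  -- cycle start, plus the Lipschitz error of up to `K M` steps taken within distance `R`. Hence the
  -- bound reproduces itself by induction.
  set R := η * K * σ * G / (1 - η * K * β * σ ^ 2 * M) with hR
  have hq := H.rate_bounds.1
  have h1q : 0 < 1 - η * K * β * σ ^ 2 * M := by linarith
  have hη := H.η_pos
  have hσ := H.σ_pos
  have hβ := H.β_pos
  have hG0 : 0 ≤ G := Finset.sum_nonneg fun i _ => (H.pos _).le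
  have hR0 : 0 ≤ R := by positivity
  have hbd : ∀ k ≤ K * M, η * σ * (∑ j ∈ Finset.range k, ∑ i, b (n + j) i * h (inner ℝ (z i) W))
      + η * (β * σ ^ 2) * k * R ≤ R := by
    intro k hk
    have h1 : ∑ j ∈ Finset.range k, ∑ i, b (n + j) i * h (inner ℝ (z i) W) ≤ K * G := by
      calc _ ≤ ∑ j ∈ Finset.range (K * M), ∑ i, b (n + j) i * h (inner ℝ (z i) W) :=
            Finset.sum_le_sum_of_subset_of_nonneg (Finset.range_mono hk) fun j _ _ =>
              Finset.sum_nonneg fun i _ => mul_nonneg (H.weight_nonneg _ i) (H.pos _).le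
        _ = K * G := by
            rw [Finset.sum_comm, hG, Finset.mul_sum]
            refine Finset.sum_congr rfl fun i _ => ?_
            rw [← Finset.sum_mul, H.sum_weight c i]
    have h2 : (k : ℝ) ≤ K * M := by exact_mod_cast hk
    calc _ ≤ η * σ * (K * G) + η * (β * σ ^ 2) * (K * M) * R := by gcongr
      _ = η * K * σ * G + η * K * β * σ ^ 2 * M * R := by ring
      _ = R * (1 - η * K * β * σ ^ 2 * M) + η * K * β * σ ^ 2 * M * R := by
        rw [hR, div_mul_cancel₀ _ h1q.ne']
      _ = R := by ring
  have hind : ∀ k ≤ K * M, ‖u (n + k) - W‖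
      ≤ η * σ * (∑ j ∈ Finset.range k, ∑ i, b (n + j) i * h (inner ℝ (z i) W))
        + η * (β * σ ^ 2) * k * R := by
    intro k
    induction k with
    | zero => intro _; simp [hW]
    | succ k ih =>
      intro hk
      have ih' := ih (by omega)
      have hle := ih'.trans (hbd k (by omega))
      have hsplit : u (n + (k + 1)) - W = (u (n + k) - W)
          + (η • ∑ i, (b (n + k) i * h (inner ℝ (z i) W)) • z i
          + η • ∑ i, (b (n + k) i * (h (inner ℝ (z i) (u (n + k))) - h (inner ℝ (z i) W))) • z i) := by
        rw [← add_assoc, H.step, ← smul_add, ← Finset.sum_add_distrib]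
        have : ∀ i, (b (n + k) i * h (inner ℝ (z i) W)) • z i
            + (b (n + k) i * (h (inner ℝ (z i) (u (n + k))) - h (inner ℝ (z i) W))) • z i
            = (b (n + k) i * h (inner ℝ (z i) (u (n + k)))) • z i := by
          intro i; rw [← add_smul]; congr 1; ring
        simp_rw [this]
        abel
      rw [hsplit]
      refine (norm_add_le _ _).trans ((add_le_add le_rfl (norm_add_le _ _)).trans ?_)
      rw [norm_smul, norm_smul, Real.norm_of_nonneg hη.le, Finset.sum_range_succ]
      have h1 := H.norm_sum_weight_le (n + k) W
      have h2 := (H.norm_sum_sub_le (n + k) (u (n + k)) W).trans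
        (mul_le_mul_of_nonneg_left hle (by positivity))
      have h3 := mul_le_mul_of_nonneg_left h1 hη.le
      have h4 := mul_le_mul_of_nonneg_left h2 hη.le
      push_cast
      linarith
  exact (hind j hj).trans (hbd j hj)

theorem cycle_sum (H : IncrementalDescent z h β σ φ η K M b u) (n k : ℕ) :
    u (n + k) = u n
      + η • ∑ j ∈ Finset.range k, ∑ i, (b (n + j) i * h (inner ℝ (z i) (u (n + j)))) • z i := by
  induction k with
  | zero => simp
  | succ k ih => rw [Finset.sum_range_succ, smul_add, ← add_assoc (u n), ← ih, ← add_assoc n,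
      H.step (n + k)]

/-- A cycle is a gradient step for the total loss up to a relative error. -/
theorem norm_cycle_sub_le (H : IncrementalDescent z h β σ φ η K M b u) (c : ℕ) :
    ‖u ((c + 1) * (K * M)) - u (c * (K * M))
        - (η * K) • ∑ i, h (inner ℝ (z i) (u (c * (K * M)))) • z i‖
      ≤ η * K * β * σ ^ 2 * M * (σ / φ) / (1 - η * K * β * σ ^ 2 * M)
        * (η * K * ‖∑ i, h (inner ℝ (z i) (u (c * (K * M)))) • z i‖) := by
  set n := c * (K * M) with hn
  set W := u n with hW
  have hη := H.η_pos
  have hσ := H.σ_pos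
  have hβ := H.β_pos
  have hφ := H.φ_pos
  have h1q : 0 < 1 - η * K * β * σ ^ 2 * M := by linarith [H.rate_bounds.1]
  -- As every index has total weight `K` in the cycle, the full step is the sum of the partial steps
  -- frozen at `W`; only differences of `h` remain.
  have e1 : (η * K) • ∑ i, h (inner ℝ (z i) W) • z i
      = η • ∑ j ∈ Finset.range (K * M), ∑ i, (b (n + j) i * h (inner ℝ (z i) W)) • z i := by
    rw [Finset.sum_comm, mul_smul, Finset.smul_sum]
    congr 1
    refine Finset.sum_congr rfl fun i _ => ?_
    rw [← Finset.sum_smul, ← Finset.sum_mul, H.sum_weight c i, mul_smul]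
  have e2 : u ((c + 1) * (K * M)) - W - (η * K) • ∑ i, h (inner ℝ (z i) W) • z i
      = η • ∑ j ∈ Finset.range (K * M), ∑ i,
        (b (n + j) i * (h (inner ℝ (z i) (u (n + j))) - h (inner ℝ (z i) W))) • z i := by
    rw [e1, add_one_mul, ← hn, H.cycle_sum n (K * M), ← hW, add_sub_cancel_left, ← smul_sub,
      ← Finset.sum_sub_distrib]
    congr 1
    refine Finset.sum_congr rfl fun j _ => ?_
    rw [← Finset.sum_sub_distrib]
    refine Finset.sum_congr rfl fun i _ => ?_
    rw [← sub_smul, mul_sub]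
  rw [e2, norm_smul, Real.norm_of_nonneg hη.le]
  have h1 : ‖∑ j ∈ Finset.range (K * M), ∑ i,
        (b (n + j) i * (h (inner ℝ (z i) (u (n + j))) - h (inner ℝ (z i) W))) • z i‖
      ≤ ∑ j ∈ Finset.range (K * M), β * σ ^ 2 * (η * K * σ * (∑ i, h (inner ℝ (z i) W))
        / (1 - η * K * β * σ ^ 2 * M)) := by
    refine (_root_.norm_sum_le _ _).trans (Finset.sum_le_sum fun j hj => ?_)
    refine (H.norm_sum_sub_le _ _ _).trans ?_
    gcongr
    exact H.norm_sub_start_le c (Finset.mem_range.1 hj).le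
  rw [Finset.sum_const, Finset.card_range, nsmul_eq_mul] at h1
  have h2 : ∑ i, h (inner ℝ (z i) W) ≤ ‖∑ i, h (inner ℝ (z i) W) • z i‖ / φ := by
    rw [le_div_iff₀ hφ, mul_comm]; exact H.margin_mul_sum_le W
  calc _ ≤ η * (((K * M : ℕ) : ℝ) * (β * σ ^ 2 * (η * K * σ *
          (‖∑ i, h (inner ℝ (z i) W) • z i‖ / φ) / (1 - η * K * β * σ ^ 2 * M)))) := by
        refine mul_le_mul_of_nonneg_left (h1.trans ?_) hη.le
        gcongr
    _ = _ := by push_cast; field_simp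

/-- The gradient of the total loss at the starts of the cycles tends to zero. -/
theorem tendsto_norm_gradient (H : IncrementalDescent z h β σ φ η K M b u) {ℓ : ℝ → ℝ}
    (hd : Differentiable ℝ ℓ) (hℓ : ∀ x, deriv ℓ x = -h x) (hpos : ∀ x, 0 ≤ ℓ x) :
    Tendsto (fun c => ‖∑ i, h (inner ℝ (z i) (u (c * (K * M)))) • z i‖) atTop (𝓝 0) := by
  set q := η * K * β * σ ^ 2 with hq
  set r := q * M * (σ / φ) / (1 - q * M) with hr
  have hη := H.η_pos
  have hσ := H.σ_pos
  have hβ := H.β_pos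
  have hφ := H.φ_pos
  have hK : (0 : ℝ) < K := by exact_mod_cast H.one_le_K
  -- First-order gain `1 - r` minus second-order cost `q (1 + r)²`; its positivity is the second
  -- half of `rate_bounds`.
  set δ := η * K * ((1 - r) - q * (1 + r) ^ 2) with hδ
  have hδ0 : 0 < δ := mul_pos (by positivity) (sub_pos.2 H.rate_bounds.2)
  set g : ℕ → E := fun c => ∑ i, h (inner ℝ (z i) (u (c * (K * M)))) • z i with hg
  set L : ℕ → ℝ := fun c => ∑ i, ℓ (inner ℝ (z i) (u (c * (K * M)))) with hL
  have hdesc : ∀ c, δ * ‖g c‖ ^ 2 ≤ L c - L (c + 1) := by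
    intro c
    set W := u (c * (K * M)) with hW
    set Δ := u ((c + 1) * (K * M)) - W with hΔ
    have herr : ‖Δ - (η * K) • g c‖ ≤ r * (η * K * ‖g c‖) := H.norm_cycle_sub_le c
    have hΔn : ‖Δ‖ ≤ (1 + r) * (η * K * ‖g c‖) := by
      have h1 := norm_le_norm_add_norm_sub' Δ ((η * K) • g c)
      rw [norm_smul, Real.norm_of_nonneg (by positivity)] at h1
      linarith
    have hinn : (1 - r) * (η * K) * ‖g c‖ ^ 2 ≤ inner ℝ (g c) Δ := by
      have h1 : inner ℝ (g c) Δ = η * K * ‖g c‖ ^ 2 + inner ℝ (g c) (Δ - (η * K) • g c) := by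
        rw [inner_sub_right (g c) Δ, inner_smul_right, real_inner_self_eq_norm_sq]; ring
      have h2 := neg_le_of_abs_le (abs_real_inner_le_norm (g c) (Δ - (η * K) • g c))
      have h3 := mul_le_mul_of_nonneg_left herr (norm_nonneg (g c))
      rw [h1]
      nlinarith
    have hup : L (c + 1) ≤ L c - inner ℝ (g c) Δ + β * σ ^ 2 * ‖Δ‖ ^ 2 := by
      have h1 : ∀ i, ℓ (inner ℝ (z i) (u ((c + 1) * (K * M)))) ≤ ℓ (inner ℝ (z i) W)
          - inner ℝ (h (inner ℝ (z i) W) • z i) Δ + β * (inner ℝ (z i) Δ) ^ 2 := by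
        intro i
        have h2 := le_add_deriv_mul_add_sq hd (β := β) (fun x y => by
          rw [hℓ, hℓ, neg_sub_neg, abs_sub_comm]; exact H.lipschitz x y) hβ.le
          (inner ℝ (z i) W) (inner ℝ (z i) (u ((c + 1) * (K * M))))
        rw [← inner_sub_right, ← hΔ, hℓ] at h2
        rw [real_inner_smul_left]
        linarith
      have h2 := Finset.sum_le_sum fun i (_ : i ∈ Finset.univ) => h1 i
      rw [Finset.sum_add_distrib, Finset.sum_sub_distrib, ← sum_inner, ← Finset.mul_sum] at h2
      have h3 : ∑ i, (inner ℝ (z i) Δ : ℝ) ^ 2 ≤ (σ * ‖Δ‖) ^ 2 :=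
        (Real.sqrt_le_left (by positivity)).1 (H.sqrt_sum_inner_sq_le Δ)
      have h4 := mul_le_mul_of_nonneg_left h3 hβ.le
      simp only [hL, hg]
      linarith
    have h5 : β * σ ^ 2 * ‖Δ‖ ^ 2 ≤ β * σ ^ 2 * ((1 + r) * (η * K * ‖g c‖)) ^ 2 := by gcongr
    have h6 : β * σ ^ 2 * ((1 + r) * (η * K * ‖g c‖)) ^ 2
        = η * K * (q * (1 + r) ^ 2) * ‖g c‖ ^ 2 := by rw [hq]; ring
    rw [hδ]
    nlinarith
  have hL0 : ∀ c, 0 ≤ L c := fun c => Finset.sum_nonneg fun i _ => hpos _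
  have hsum : Summable fun c => δ * ‖g c‖ ^ 2 := by
    refine summable_of_sum_range_le (c := L 0) (fun c => by positivity) fun m => ?_
    calc _ ≤ ∑ c ∈ Finset.range m, (L c - L (c + 1)) := Finset.sum_le_sum fun c _ => hdesc c
      _ = L 0 - L m := Finset.sum_range_sub' _ _
      _ ≤ L 0 := by linarith [hL0 m]
  have h1 := (hsum.tendsto_atTop_zero.const_mul δ⁻¹).sqrt
  simpa only [inv_mul_cancel_left₀ hδ0.ne', Real.sqrt_sq (norm_nonneg _), mul_zero, Real.sqrt_zero]
    using h1

theorem tendsto_sum (H : IncrementalDescent z h β σ φ η K M b u) {ℓ : ℝ → ℝ}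
    (hd : Differentiable ℝ ℓ) (hℓ : ∀ x, deriv ℓ x = -h x) (hpos : ∀ x, 0 ≤ ℓ x) :
    Tendsto (fun c => ∑ i, h (inner ℝ (z i) (u (c * (K * M))))) atTop (𝓝 0) := by
  have h1 := (H.tendsto_norm_gradient hd hℓ hpos).div_const φ
  rw [zero_div] at h1
  refine squeeze_zero (fun c => Finset.sum_nonneg fun i _ => (H.pos _).le) (fun c => ?_) h1
  rw [le_div_iff₀ H.φ_pos, mul_comm]
  exact H.margin_mul_sum_le _

/-- All margins tend to infinity along the starts of the cycles. -/
theorem tendsto_inner_atTop (H : IncrementalDescent z h β σ φ η K M b u) {ℓ : ℝ → ℝ}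
    (hd : Differentiable ℝ ℓ) (hℓ : ∀ x, deriv ℓ x = -h x) (hpos : ∀ x, 0 ≤ ℓ x)
    (hbelow : ∀ A, ∃ m > 0, ∀ x ≤ A, m ≤ h x) (i : ι) :
    Tendsto (fun c => inner ℝ (z i) (u (c * (K * M)))) atTop atTop := by
  refine tendsto_atTop.2 fun A => ?_
  -- On `x ≤ A` the function `h` is bounded away from zero, so a sum of values below `m` leaves no
  -- margin there.
  obtain ⟨m, hm, hA⟩ := hbelow A
  filter_upwards [(H.tendsto_sum hd hℓ hpos).eventually (gt_mem_nhds hm)] with c hc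
  by_contra! hcon
  have h1 := hA _ hcon.le
  have h2 := Finset.single_le_sum (f := fun i => h (inner ℝ (z i) (u (c * (K * M)))))
    (fun j _ => (H.pos _).le) (Finset.mem_univ i)
  linarith

/-- The iterates of a cycle get uniformly close to its start. -/
theorem exists_tendsto_bound (H : IncrementalDescent z h β σ φ η K M b u) {ℓ : ℝ → ℝ}
    (hd : Differentiable ℝ ℓ) (hℓ : ∀ x, deriv ℓ x = -h x) (hpos : ∀ x, 0 ≤ ℓ x) :
    ∃ R : ℕ → ℝ, Tendsto R atTop (𝓝 0) ∧
      ∀ c, ∀ j ≤ K * M, ‖u (c * (K * M) + j) - u (c * (K * M))‖ ≤ R c := by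
  refine ⟨_, ?_, fun c j hj => H.norm_sub_start_le c hj⟩
  simpa using ((H.tendsto_sum hd hℓ hpos).const_mul (η * K * σ)).div_const
    (1 - η * K * β * σ ^ 2 * M)

end IncrementalDescent

end SeqGD

/-! ### Exponential asymptotics of a cycle and consequences of the loss assumptions. -/

namespace SeqGD

namespace IncrementalDescent

variable {E ι : Type*} [NormedAddCommGroup E] [InnerProductSpace ℝ E] [Fintype ι] {z : ι → E}
  {h : ℝ → ℝ} {β σ φ η : ℝ} {K M : ℕ} {b : ℕ → ι → ℝ} {u : ℕ → E}

/-- If `h` has an exponential tail, then a cycle is an exponential step up to relative errors that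
tend to zero. -/
theorem exists_cycle_eq (H : IncrementalDescent z h β σ φ η K M b u)
    (htail : Tendsto (fun x => h x * Real.exp x) atTop (𝓝 1))
    (hinner : ∀ i, Tendsto (fun c => inner ℝ (z i) (u (c * (K * M)))) atTop atTop)
    {R : ℕ → ℝ} (hR : Tendsto R atTop (𝓝 0))
    (hdist : ∀ c, ∀ j ≤ K * M, ‖u (c * (K * M) + j) - u (c * (K * M))‖ ≤ R c) :
    ∃ ε : ℕ → ι → ℝ, (∀ i, Tendsto (fun c => ε c i) atTop (𝓝 0)) ∧
      ∀ c, u ((c + 1) * (K * M)) = u (c * (K * M)) + (η * K) •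
        ∑ i, (Real.exp (-inner ℝ (z i) (u (c * (K * M)))) * (1 + ε c i)) • z i := by
  have hK : (0 : ℝ) < K := by exact_mod_cast H.one_le_K
  -- Relative deviation of `h` at the `j`-th iterate of the cycle from the exponential at its start.
  -- It vanishes in the limit by the tail of `h` and the vanishing displacement.
  set D : ℕ → ι → ℕ → ℝ := fun c i j => h (inner ℝ (z i) (u (c * (K * M) + j)))
    * Real.exp (inner ℝ (z i) (u (c * (K * M)))) - 1 with hD
  have hD0 : ∀ i, ∀ j ∈ Finset.range (K * M), Tendsto (fun c => |D c i j|) atTop (𝓝 0) := by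
    intro i j hj
    have h1 : Tendsto (fun c => inner ℝ (z i) (u (c * (K * M) + j) - u (c * (K * M)))) atTop
        (𝓝 (0 : ℝ)) := by
      have h2 : Tendsto (fun c => u (c * (K * M) + j) - u (c * (K * M))) atTop (𝓝 0) :=
        squeeze_zero_norm (fun c => hdist c j (Finset.mem_range.1 hj).le) hR
      simpa using (tendsto_const_nhds (x := z i)).inner h2
    have h3 : Tendsto (fun c => inner ℝ (z i) (u (c * (K * M) + j))) atTop atTop := by
      refine ((hinner i).atTop_add h1).congr fun c => ?_
      rw [inner_sub_right]; ring
    have h4 := (htail.comp h3).mul ((Real.continuous_exp.tendsto _).comp h1.neg)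
    have h5 := (h4.sub_const 1).abs
    rw [neg_zero, Real.exp_zero, one_mul, sub_self, abs_zero] at h5
    refine h5.congr fun c => ?_
    simp only [hD, Function.comp_apply]
    rw [mul_assoc, ← Real.exp_add, inner_sub_right]
    congr 4
    ring
  -- The weighted mean of the deviations: the weights sum to `K`, so `1 + ε` is the same mean of `1
  -- + D`.
  refine ⟨fun c i => (K : ℝ)⁻¹ * ∑ j ∈ Finset.range (K * M), b (c * (K * M) + j) i * D c i j,
    fun i => ?_, fun c => ?_⟩
  · have h1 : Tendsto (fun c => (K : ℝ)⁻¹ * ∑ j ∈ Finset.range (K * M), |D c i j|) atTop (𝓝 0) := by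
      simpa using (tendsto_finsetSum (Finset.range (K * M)) (hD0 i)).const_mul (K : ℝ)⁻¹
    refine squeeze_zero_norm (fun c => ?_) h1
    rw [norm_mul, Real.norm_of_nonneg (inv_nonneg.2 hK.le)]
    gcongr
    refine (_root_.norm_sum_le (Finset.range (K * M)) _).trans (Finset.sum_le_sum fun j _ => ?_)
    rw [norm_mul, Real.norm_of_nonneg (H.weight_nonneg _ _), Real.norm_eq_abs]
    exact mul_le_of_le_one_left (abs_nonneg _) (H.weight_le_one _ _)
  · rw [add_one_mul, H.cycle_sum (c * (K * M)) (K * M), mul_smul]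
    congr 2
    rw [Finset.sum_comm, Finset.smul_sum]
    refine Finset.sum_congr rfl fun i _ => ?_
    rw [← Finset.sum_smul, smul_smul]
    congr 1
    have h1 : (1 : ℝ) + (K : ℝ)⁻¹ * ∑ j ∈ Finset.range (K * M), b (c * (K * M) + j) i * D c i j
        = (K : ℝ)⁻¹ * ∑ j ∈ Finset.range (K * M), b (c * (K * M) + j) i * (1 + D c i j) := by
      simp_rw [mul_add, mul_one]
      rw [Finset.sum_add_distrib, H.sum_weight c i, mul_add, inv_mul_cancel₀ hK.ne']
    rw [h1, mul_left_comm (Real.exp _), mul_inv_cancel_left₀ hK.ne', Finset.mul_sum]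
    refine Finset.sum_congr rfl fun j _ => ?_
    simp only [hD, add_sub_cancel]
    have h2 := Real.exp_neg (inner ℝ (z i) (u (c * (K * M))))
    rw [h2]
    field_simp

end IncrementalDescent

/-- Near `-∞` the limsup condition gives the bound; on the remaining compact interval the continuous
negative derivative attains its maximum. -/
theorem LossShape.exists_le_neg_deriv {ℓ : ℝ → ℝ} {β : ℝ} (hloss : LossShape ℓ β) (A : ℝ) :
    ∃ m > 0, ∀ x ≤ A, m ≤ -deriv ℓ x := by
  obtain ⟨c, hc, hev⟩ := hloss.limsup_deriv_neg
  obtain ⟨B, hB⟩ := eventually_atBot.1 hev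
  have hcont : Continuous (deriv ℓ) := by
    have : LipschitzWith (Real.toNNReal β) (deriv ℓ) := by
      refine LipschitzWith.of_dist_le_mul fun x y => ?_
      rw [Real.dist_eq, Real.dist_eq]
      refine (hloss.smooth x y).trans ?_
      gcongr
      exact Real.le_coe_toNNReal β
    exact this.continuous
  rcases le_or_gt A B with h | h
  · exact ⟨-c, by linarith, fun x hx => by linarith [hB x (hx.trans h)]⟩
  · obtain ⟨p, -, hp⟩ := isCompact_Icc.exists_isMaxOn (Set.nonempty_Icc.2 h.le) hcont.continuousOn
    refine ⟨min (-c) (-deriv ℓ p), lt_min (by linarith) (by linarith [hloss.deriv_neg p]),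
      fun x hx => ?_⟩
    rcases le_or_gt x B with hx' | hx'
    · exact (min_le_left _ _).trans (by linarith [hB x hx'])
    · exact (min_le_right _ _).trans (neg_le_neg (hp ⟨hx'.le, hx⟩))

theorem TightExponentialTail.tendsto {ℓ : ℝ → ℝ} (h : TightExponentialTail ℓ) :
    Tendsto (fun x => -deriv ℓ x * Real.exp x) atTop (𝓝 1) := by
  obtain ⟨p, hp, m, hm, B, -, hB⟩ := h
  have key : ∀ μ > (0 : ℝ), Tendsto (fun x => Real.exp (-(μ * x))) atTop (𝓝 0) := fun μ hμ =>
    Real.tendsto_exp_neg_atTop_nhds_zero.comp (tendsto_id.const_mul_atTop hμ)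
  have h1 := (key m hm).const_sub 1
  have h2 := (key p hp).const_add 1
  rw [sub_zero] at h1
  rw [add_zero] at h2
  have hexp : ∀ x : ℝ, Real.exp (-x) * Real.exp x = 1 := fun x => by
    rw [← Real.exp_add, neg_add_cancel, Real.exp_zero]
  refine tendsto_of_tendsto_of_tendsto_of_le_of_le' h1 h2 ?_ ?_
  · filter_upwards [eventually_gt_atTop B] with x hx
    have := mul_le_mul_of_nonneg_right (hB x hx).1 (Real.exp_pos x).le
    rwa [mul_assoc, hexp, mul_one] at this
  · filter_upwards [eventually_gt_atTop B] with x hx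
    have := mul_le_mul_of_nonneg_right (hB x hx).2 (Real.exp_pos x).le
    rwa [mul_assoc, hexp, mul_one] at this

end SeqGD

/-- In an eigenbasis of `T* T`, `‖T v‖²` is the eigenvalue-weighted sum of squared coordinates of
`v`, and the largest eigenvalue is the square of the zeroth singular value. -/
theorem LinearMap.norm_apply_le_singularValues_zero {E F : Type*} [NormedAddCommGroup E]
    [InnerProductSpace ℝ E] [FiniteDimensional ℝ E] [NormedAddCommGroup F] [InnerProductSpace ℝ F]
    [FiniteDimensional ℝ F] (T : E →ₗ[ℝ] F) (v : E) : ‖T v‖ ≤ T.singularValues 0 * ‖v‖ := by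
  rcases Nat.eq_zero_or_pos (Module.finrank ℝ E) with h0 | hpos
  · have : v = 0 := by
      have := Module.finrank_zero_iff.1 h0
      exact Subsingleton.elim _ _
    simp [this]
  · set hT := T.isSymmetric_adjoint_comp_self
    set e := hT.eigenvectorBasis rfl with he
    have h1 : ‖T v‖ ^ 2 = ∑ i, hT.eigenvalues rfl i * (e.repr v i) ^ 2 := by
      rw [← real_inner_self_eq_norm_sq, ← LinearMap.adjoint_inner_left, ← LinearMap.comp_apply,
        ← e.repr.inner_map_map, PiLp.inner_apply]
      refine Finset.sum_congr rfl fun i _ => ?_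
      rw [hT.eigenvectorBasis_apply_self_apply rfl v i]
      simp [he]; ring
    have h2 : ‖v‖ ^ 2 = ∑ i, (e.repr v i) ^ 2 := by
      rw [← e.repr.norm_map, EuclideanSpace.real_norm_sq_eq]
    have h3 : ‖T v‖ ^ 2 ≤ (T.singularValues 0 * ‖v‖) ^ 2 := by
      rw [mul_pow, h1, h2, T.sq_singularValues_of_lt rfl hpos, Finset.mul_sum]
      gcongr with i
      exact hT.eigenvalues_antitone rfl (Fin.mk_le_of_le_val (Nat.zero_le _))
    exact (sq_le_sq₀ (norm_nonneg _)
      (mul_nonneg (T.singularValues_nonneg 0) (norm_nonneg _))).1 h3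

/-! ### The data set: flattened iteration, max-margin geometry and the residual system. -/

namespace SeqGD

namespace TaskData

variable {d N M : ℕ} (D : TaskData d N M)

/-- The data points multiplied by their labels. -/
noncomputable def signed (i : Fin N) : EuclideanSpace ℝ (Fin d) := D.y i • D.x i

theorem inner_signed (i : Fin N) (w : EuclideanSpace ℝ (Fin d)) :
    (inner ℝ (D.signed i) w : ℝ) = D.y i * inner ℝ (D.x i) w := real_inner_smul_left _ _ _

theorem y_mul_self (i : Fin N) : D.y i * D.y i = 1 := by
  rcases D.y_eq i with h | h <;> rw [h] <;> norm_num

theorem x_eq_smul_signed (i : Fin N) : D.x i = D.y i • D.signed i := by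
  rw [signed, smul_smul, y_mul_self, one_smul]

theorem sigmaMax_nonneg : 0 ≤ D.sigmaMax := LinearMap.singularValues_nonneg _ _

theorem norm_sum_smul_signed_le (a : Fin N → ℝ) :
    ‖∑ i, a i • D.signed i‖ ≤ D.sigmaMax * √(∑ i, a i ^ 2) := by
  have h1 := LinearMap.norm_apply_le_singularValues_zero (Matrix.toEuclideanLin D.dataMatrix)
    (WithLp.toLp 2 fun i => a i * D.y i)
  have h2 : Matrix.toEuclideanLin D.dataMatrix (WithLp.toLp 2 fun i => a i * D.y i)
      = ∑ i, a i • D.signed i := by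
    ext j
    simp only [Matrix.toLpLin_apply, Matrix.mulVec, dotProduct, dataMatrix, signed,
      Matrix.of_apply, WithLp.ofLp_sum, Finset.sum_apply, PiLp.smul_apply, smul_eq_mul]
    exact Finset.sum_congr rfl fun i _ => by ring
  have h3 : ‖(WithLp.toLp 2 fun i => a i * D.y i : EuclideanSpace ℝ (Fin N))‖
      = √(∑ i, a i ^ 2) := by
    rw [EuclideanSpace.norm_eq]
    congr 1
    refine Finset.sum_congr rfl fun i _ => ?_
    rw [Real.norm_eq_abs, sq_abs, mul_pow, sq (D.y i), y_mul_self, mul_one]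
  rwa [h2, h3] at h1

theorem gradient_stageLoss {ℓ : ℝ → ℝ} (hd : Differentiable ℝ ℓ) (t : ℕ)
    (w : EuclideanSpace ℝ (Fin d)) :
    gradient (D.stageLoss ℓ t) w = ∑ i with (D.task i : ℕ) = t % M,
      deriv ℓ (inner ℝ (D.signed i) w) • D.signed i := by
  refine HasGradientAt.gradient ?_
  rw [hasGradientAt_iff_hasFDerivAt, map_sum]
  have h1 : D.stageLoss ℓ t = fun w => ∑ i with (D.task i : ℕ) = t % M,
      ℓ (inner ℝ (D.signed i) w) := by
    funext w; simp only [stageLoss, inner_signed]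
  rw [h1]
  refine HasFDerivAt.fun_sum fun i _ => ?_
  have h2 := (hd (inner ℝ (D.signed i) w)).hasDerivAt.comp_hasFDerivAt w
    (innerSL ℝ (D.signed i)).hasFDerivAt
  refine h2.congr_fderiv ?_
  ext v
  simp

/-- The weight of a data point at step `n` of the flattened iteration: whether its task is the one
that is presented. -/
noncomputable def weight (K n : ℕ) (i : Fin N) : ℝ := if (D.task i : ℕ) = n / K % M then 1 else 0

theorem gdStep_eq {ℓ : ℝ → ℝ} (hd : Differentiable ℝ ℓ) (η : ℝ) (K n : ℕ)
    (w : EuclideanSpace ℝ (Fin d)) :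
    D.gdStep ℓ η (n / K) w = w + η • ∑ i,
      (D.weight K n i * -deriv ℓ (inner ℝ (D.signed i) w)) • D.signed i := by
  rw [gdStep, gradient_stageLoss D hd, sub_eq_add_neg, ← smul_neg, ← Finset.sum_neg_distrib,
    Finset.sum_filter]
  congr 2
  refine Finset.sum_congr rfl fun i _ => ?_
  rw [weight]
  split_ifs <;> simp

/-- All iterates in one sequence. -/
noncomputable def flat (ℓ : ℝ → ℝ) (η : ℝ) (K : ℕ) (w₀ : EuclideanSpace ℝ (Fin d)) (n : ℕ) :
    EuclideanSpace ℝ (Fin d) := D.iterate ℓ η K w₀ (n / K) (n % K)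

theorem flat_mul_add (ℓ : ℝ → ℝ) (η : ℝ) {K : ℕ} (w₀ : EuclideanSpace ℝ (Fin d)) (t : ℕ) {k : ℕ}
    (hk : k < K) : D.flat ℓ η K w₀ (t * K + k) = D.iterate ℓ η K w₀ t k := by
  rw [flat, mul_comm t K, Nat.mul_add_div (by omega), Nat.div_eq_of_lt hk, add_zero,
    Nat.mul_add_mod, Nat.mod_eq_of_lt hk]

theorem flat_succ (ℓ : ℝ → ℝ) (η : ℝ) {K : ℕ} (hK : 1 ≤ K) (w₀ : EuclideanSpace ℝ (Fin d))
    (n : ℕ) : D.flat ℓ η K w₀ (n + 1) = D.gdStep ℓ η (n / K) (D.flat ℓ η K w₀ n) := by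
  have hn : n = n / K * K + n % K := (Nat.div_add_mod' n K).symm
  have hlt : n % K < K := Nat.mod_lt _ hK
  set t := n / K with ht
  set k := n % K with hk
  rw [hn, flat_mul_add D ℓ η w₀ t hlt]
  -- At `k + 1 = K` the step closes its stage, and its result is by definition the start of stage `t
  -- + 1`.
  rcases Nat.lt_or_ge (k + 1) K with h | h
  · rw [add_assoc, flat_mul_add D ℓ η w₀ t h, iterate, iterate, Function.iterate_succ_apply']
  · have hk1 : K = k + 1 := by omega
    have h1 : t * K + k + 1 = (t + 1) * K + 0 := by rw [add_one_mul]; omega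
    rw [h1, flat_mul_add D ℓ η w₀ (t + 1) hK, iterate, iterate, Function.iterate_zero_apply,
      ← Function.iterate_succ_apply' (D.gdStep ℓ η t), ← Nat.succ_eq_add_one] at *
    rw [stageStart, ← hk1]

/-- Within any cycle, task `m` is active exactly at the `K` offsets from `m K` to `m K + K - 1`. -/
theorem sum_weight {K : ℕ} (hK : 1 ≤ K) (c : ℕ) (i : Fin N) :
    ∑ j ∈ Finset.range (K * M), D.weight K (c * (K * M) + j) i = K := by
  have h1 : (Finset.range (K * M)).filter (fun j => (D.task i : ℕ) = (c * (K * M) + j) / K % M)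
      = Finset.Ico (D.task i * K) (D.task i * K + K) := by
    ext j
    have hm := (D.task i).isLt
    have h2 : (c * (K * M) + j) / K % M = j / K % M := by
      have : c * (K * M) + j = K * (M * c) + j := by ring
      rw [this, Nat.mul_add_div (by omega), Nat.mul_add_mod]
    rw [Finset.mem_filter, Finset.mem_range, Finset.mem_Ico, h2]
    have h4 : j < K * M ↔ j / K < M := by rw [Nat.div_lt_iff_lt_mul (by omega), mul_comm]
    have h5 : j / K = D.task i ↔ D.task i * K ≤ j ∧ j < D.task i * K + K := by
      rw [Nat.div_eq_iff (by omega)]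
      omega
    rw [h4, ← h5]
    constructor
    · rintro ⟨h6, h7⟩
      rw [h7, Nat.mod_eq_of_lt h6]
    · intro h6
      rw [h6]
      exact ⟨hm, (Nat.mod_eq_of_lt hm).symm⟩
  simp only [weight]
  rw [Finset.sum_boole, h1, Nat.card_Ico, Nat.add_sub_cancel_left]

theorem inner_signed_maxMargin (hsep : D.Separable) (i : Fin N) :
    1 ≤ (inner ℝ (D.signed i) D.maxMargin : ℝ) := by
  rw [inner_signed]; exact (D.isMaxMargin_maxMargin hsep).1 i

theorem norm_maxMargin_pos [Nonempty (Fin N)] (hsep : D.Separable) : 0 < ‖D.maxMargin‖ := by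
  obtain ⟨i⟩ := ‹Nonempty (Fin N)›
  rw [norm_pos_iff]
  intro h0
  have := D.inner_signed_maxMargin hsep i
  rw [h0, inner_zero_right] at this
  linarith

theorem margin_le (i : Fin N) :
    D.margin ≤ D.y i * inner ℝ (D.x i) D.maxMargin / ‖D.maxMargin‖ :=
  ciInf_le (Set.finite_range _).bddBelow i

/-- Some constraint is active at the minimizer: if all values exceeded `1`, shrinking the vector
would keep it feasible and lower its norm. -/
theorem margin_mul_norm [Nonempty (Fin N)] (hsep : D.Separable) :
    D.margin * ‖D.maxMargin‖ = 1 := by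
  have hn := D.norm_maxMargin_pos hsep
  have hs := D.isMaxMargin_maxMargin hsep
  apply le_antisymm
  · by_contra! hlt
    set s := D.margin * ‖D.maxMargin‖ with hsdef
    have hs0 : 0 < s := by linarith
    have hfeas : s⁻¹ • D.maxMargin ∈ D.feasible := by
      intro i
      have h1 := D.margin_le i
      rw [le_div_iff₀ hn, ← hsdef] at h1
      rw [inner_smul_right, mul_left_comm, ← div_eq_inv_mul, le_div_iff₀ hs0, one_mul]
      exact h1
    have h2 := hs.2 _ hfeas
    rw [norm_smul, norm_inv, Real.norm_of_nonneg hs0.le, mul_pow] at h2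
    have h3 : s⁻¹ < 1 := inv_lt_one_of_one_lt₀ hlt
    have h4 : (s⁻¹) ^ 2 < 1 := pow_lt_one₀ (inv_nonneg.2 hs0.le) h3 two_ne_zero
    nlinarith [pow_pos hn 2]
  · rw [← div_le_iff₀ hn]
    refine le_ciInf fun i => ?_
    gcongr
    exact hs.1 i

theorem margin_nonneg (hsep : D.Separable) : 0 ≤ D.margin :=
  Real.iInf_nonneg fun i =>
    div_nonneg (zero_le_one.trans ((D.isMaxMargin_maxMargin hsep).1 i)) (norm_nonneg _)

theorem mem_supportSet_iff [Nonempty (Fin N)] (hsep : D.Separable) (i : Fin N) :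
    i ∈ D.supportSet ↔ (inner ℝ (D.signed i) D.maxMargin : ℝ) = 1 := by
  have hn := D.norm_maxMargin_pos hsep
  rw [supportSet, Finset.mem_filter, div_eq_iff hn.ne', D.margin_mul_norm hsep, inner_signed]
  simp

theorem maxMargin_eq {α : Fin N → ℝ} (hα : D.IsDual α) :
    D.maxMargin = ∑ i ∈ D.supportSet, α i • D.signed i := by
  simp only [signed, smul_smul]
  exact hα.2.2

/-- Uniqueness of the positive dual coefficients makes the support vectors independent. -/
theorem linearIndependent_signed (hnd : D.NonDegenerate) {α : Fin N → ℝ} (hα : D.IsDual α) :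
    LinearIndependent ℝ fun i : D.supportSet => D.signed i := by
  rw [Fintype.linearIndependent_iff]
  intro g hg i
  set γ : Fin N → ℝ := fun j => if h : j ∈ D.supportSet then g ⟨j, h⟩ else 0 with hγ
  have hγsum : ∑ j ∈ D.supportSet, γ j • D.signed j = 0 := by
    rw [← Finset.sum_coe_sort, ← hg]
    refine Finset.sum_congr rfl fun j _ => ?_
    simp [hγ]
  -- A linear relation `γ` yields further dual coefficients `α + e γ`, still positive for small `e >
  -- 0`; uniqueness then forces `γ = 0`.
  have hev : ∀ᶠ e in 𝓝[>] (0 : ℝ), ∀ j ∈ D.supportSet, 0 < α j + e * γ j := by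
    refine (Finset.eventually_all _).2 fun j hj => ?_
    have h1 : Tendsto (fun e : ℝ => α j + e * γ j) (𝓝[>] 0) (𝓝 (α j + 0 * γ j)) :=
      Tendsto.mono_left (Continuous.tendsto (by fun_prop) 0) nhdsWithin_le_nhds
    rw [zero_mul, add_zero] at h1
    exact h1.eventually (lt_mem_nhds (hα.1 j hj))
  obtain ⟨e, he, he0⟩ := (hev.and self_mem_nhdsWithin).exists
  have hdual : D.IsDual fun j => α j + e * γ j := by
    refine ⟨he, fun j hj => ?_, ?_⟩
    · simp [hγ, hj, hα.2.1 j hj]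
    · have h1 : ∑ j ∈ D.supportSet, ((α j + e * γ j) * D.y j) • D.x j
          = ∑ j ∈ D.supportSet, α j • D.signed j + e • ∑ j ∈ D.supportSet, γ j • D.signed j := by
        rw [Finset.smul_sum, ← Finset.sum_add_distrib]
        refine Finset.sum_congr rfl fun j _ => ?_
        simp only [signed, smul_smul, ← add_smul]
        congr 1; ring
      rw [h1, hγsum, smul_zero, add_zero]
      exact D.maxMargin_eq hα
  have h2 := congrFun (hnd.unique hdual hα) i
  have h3 : e * γ i = 0 := by linarith
  have h4 := (mul_eq_zero.1 h3).resolve_left (ne_of_gt he0)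
  simpa [hγ] using h4

theorem supportSpan_eq_span_signed :
    D.supportSpan = Submodule.span ℝ (Set.range fun i : D.supportSet => D.signed i) := by
  rw [supportSpan]
  apply le_antisymm <;> rw [Submodule.span_le]
  · rintro _ ⟨i, hi, rfl⟩
    rw [x_eq_smul_signed]
    exact Submodule.smul_mem _ _ (Submodule.subset_span ⟨⟨i, hi⟩, rfl⟩)
  · rintro _ ⟨⟨i, hi⟩, rfl⟩
    exact Submodule.smul_mem _ _ (Submodule.subset_span ⟨i, hi, rfl⟩)

theorem signed_mem_supportSpan (hspan : D.SupportSpans) (i : Fin N) :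
    D.signed i ∈ D.supportSpan := by
  have h1 : D.supportSpan = Submodule.span ℝ (Set.range D.x) :=
    Submodule.eq_of_le_of_finrank_eq (Submodule.span_mono (Set.image_subset_range _ _)) hspan
  rw [h1]
  exact Submodule.smul_mem _ _ (Submodule.subset_span ⟨i, rfl⟩)

theorem maxMargin_mem_supportSpan {α : Fin N → ℝ} (hα : D.IsDual α) :
    D.maxMargin ∈ D.supportSpan := by
  rw [hα.2.2]
  exact Submodule.sum_mem _ fun i hi =>
    Submodule.smul_mem _ _ (Submodule.subset_span ⟨i, hi, rfl⟩)

/-- The margins of the support vectors, as a linear map on their span. -/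
noncomputable def supportMargins : D.supportSpan →ₗ[ℝ] EuclideanSpace ℝ D.supportSet where
  toFun v := WithLp.toLp 2 fun i => inner ℝ (D.signed i) (v : EuclideanSpace ℝ (Fin d))
  map_add' v w := by ext i; simp [inner_add_right]
  map_smul' a v := by ext i; simp [inner_smul_right]

theorem supportMargins_apply (v : D.supportSpan) (i : D.supportSet) :
    D.supportMargins v i = inner ℝ (D.signed i) (v : EuclideanSpace ℝ (Fin d)) := rfl

/-- A vector in the span with all support margins zero is orthogonal to the span, hence to itself.
-/
theorem supportMargins_injective : Function.Injective D.supportMargins := by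
  rw [← LinearMap.ker_eq_bot, LinearMap.ker_eq_bot']
  intro v hv
  have h1 : (v : EuclideanSpace ℝ (Fin d)) ∈ D.supportSpanᗮ := by
    rw [Submodule.mem_orthogonal]
    intro w hw
    rw [supportSpan_eq_span_signed] at hw
    induction hw using Submodule.span_induction with
    | mem w hw =>
      obtain ⟨i, rfl⟩ := hw
      have := congrArg (fun f : EuclideanSpace ℝ D.supportSet => f i) hv
      simpa [supportMargins_apply] using this
    | zero => simp
    | add a b _ _ ha hb => rw [inner_add_left, ha, hb, add_zero]
    | smul a b _ hb => rw [real_inner_smul_left, hb, mul_zero]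
  have h2 : (v : EuclideanSpace ℝ (Fin d)) = 0 :=
    inner_self_eq_zero.1 (Submodule.mem_orthogonal _ _ |>.1 h1 v v.2)
  exact Subtype.ext h2

theorem supportMargins_surjective (hnd : D.NonDegenerate) {α : Fin N → ℝ} (hα : D.IsDual α) :
    Function.Surjective D.supportMargins := by
  refine (LinearMap.injective_iff_surjective_of_finrank_eq_finrank ?_).1 D.supportMargins_injective
  rw [supportSpan_eq_span_signed, finrank_span_eq_card (D.linearIndependent_signed hnd hα),
    finrank_euclideanSpace]

/-- The support margins control the norm on the support span. -/
theorem exists_mul_norm_sq_le : ∃ κ > 0, ∀ v ∈ D.supportSpan,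
    κ * ‖v‖ ^ 2 ≤ ∑ i ∈ D.supportSet, (inner ℝ (D.signed i) v : ℝ) ^ 2 := by
  obtain ⟨C, hC, hanti⟩ := D.supportMargins.exists_antilipschitzWith
    (LinearMap.ker_eq_bot.2 D.supportMargins_injective)
  have hC' : (0 : ℝ) < C := hC
  refine ⟨((C : ℝ) ^ 2)⁻¹, by positivity, fun v hv => ?_⟩
  have h1 := hanti.le_mul_dist ⟨v, hv⟩ 0
  rw [map_zero, dist_zero_right, dist_zero_right] at h1
  have h2 : ‖D.supportMargins ⟨v, hv⟩‖ ^ 2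
      = ∑ i ∈ D.supportSet, (inner ℝ (D.signed i) v : ℝ) ^ 2 := by
    rw [EuclideanSpace.real_norm_sq_eq,
      ← Finset.sum_coe_sort D.supportSet fun i => (inner ℝ (D.signed i) v : ℝ) ^ 2]
    rfl
  rw [← h2, inv_mul_le_iff₀ (by positivity), ← mul_pow]
  gcongr
  exact h1

theorem exp_eq_iff {η a m : ℝ} (hη : 0 < η) (ha : 0 < a) :
    η * Real.exp (-m) = a ↔ m = Real.log (η / a) := by
  rw [mul_comm, ← eq_div_iff hη.ne', ← inv_div, ← Real.exp_log (div_pos hη ha), ← Real.exp_neg,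
    Real.exp_eq_exp, neg_inj, Real.log_exp]

/-- Logarithms make the system affine: prescribed support margins on the translate `w₀ + span`.
Bijectivity of `supportMargins` then gives existence and uniqueness. -/
theorem residualSystem_iff {η : ℝ} (hη : 0 < η) {α : Fin N → ℝ} (hα : D.IsDual α)
    (w₀ w : EuclideanSpace ℝ (Fin d)) :
    D.ResidualSystem η α w₀ w ↔
      (∀ i ∈ D.supportSet, (inner ℝ (D.signed i) w : ℝ) = Real.log (η / α i))
        ∧ w - w₀ ∈ D.supportSpan := by
  rw [ResidualSystem, sub_eq_zero, eq_comm (a := w - w₀),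
    Submodule.starProjection_eq_self_iff]
  refine and_congr (forall₂_congr fun i hi => ?_) Iff.rfl
  rw [exp_eq_iff hη (hα.1 i hi), inner_signed]

theorem exists_residualSystem {η : ℝ} (hη : 0 < η) (hnd : D.NonDegenerate) {α : Fin N → ℝ}
    (hα : D.IsDual α) (w₀ : EuclideanSpace ℝ (Fin d)) : ∃ w, D.ResidualSystem η α w₀ w := by
  obtain ⟨v, hv⟩ := D.supportMargins_surjective hnd hα
    (WithLp.toLp 2 fun i => Real.log (η / α i) - inner ℝ (D.signed i) w₀)
  refine ⟨w₀ + v, (D.residualSystem_iff hη hα _ _).2 ⟨fun i hi => ?_, ?_⟩⟩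
  · have h1 := congrArg (fun f : EuclideanSpace ℝ D.supportSet => f ⟨i, hi⟩) hv
    simp only [supportMargins_apply] at h1
    rw [inner_add_right, h1]
    ring
  · rw [add_sub_cancel_left]; exact v.2

theorem ResidualSystem.unique {η : ℝ} (hη : 0 < η) {α : Fin N → ℝ} (hα : D.IsDual α)
    {w₀ v w : EuclideanSpace ℝ (Fin d)} (hv : D.ResidualSystem η α w₀ v)
    (hw : D.ResidualSystem η α w₀ w) : v = w := by
  rw [residualSystem_iff D hη hα] at hv hw
  have hmem : v - w ∈ D.supportSpan := by
    rw [← sub_sub_sub_cancel_right v w w₀]; exact Submodule.sub_mem _ hv.2 hw.2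
  have h1 : D.supportMargins ⟨v - w, hmem⟩ = D.supportMargins 0 := by
    ext i
    rw [supportMargins_apply, supportMargins_apply]
    simp only [inner_sub_right, hv.1 i i.2, hw.1 i i.2, sub_self, ZeroMemClass.coe_zero,
      inner_zero_right]
  have h2 := congrArg Subtype.val (D.supportMargins_injective h1)
  exact sub_eq_zero.1 h2

end TaskData

end SeqGD

/-! ### Verification of the abstract hypotheses and passage from cycles to stages. -/

namespace SeqGD

namespace TaskData

variable {d N M : ℕ} (D : TaskData d N M)

theorem incrementalDescent {ℓ : ℝ → ℝ} {β η : ℝ} {K : ℕ} (w₀ : EuclideanSpace ℝ (Fin d))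
    (hK : 1 ≤ K) (hη : 0 < η) (hsep : D.Separable) (hloss : LossShape ℓ β)
    (hrate : η < D.margin ^ 2 / (2 * K * β * D.sigmaMax ^ 3 * (M * D.margin + D.sigmaMax))) :
    IncrementalDescent D.signed (fun x => -deriv ℓ x) β D.sigmaMax D.margin η K M (D.weight K)
      (D.flat ℓ η K w₀) := by
  have hK0 : (0 : ℝ) < K := by exact_mod_cast hK
  have hβ : 0 ≤ β := by
    have := (abs_nonneg _).trans (hloss.smooth 1 0)
    simpa using this
  have hφ := D.margin_nonneg hsep
  have hσ := D.sigmaMax_nonneg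
  -- The rate bound is positive, which makes `φ`, `β` and `σ` nonzero: if one of them vanished, the
  -- quotient would be `0`, by the numerator or by the convention `x / 0 = 0`.
  have hpos := hη.trans hrate
  have hφ0 : D.margin ≠ 0 := by
    intro h0; rw [h0] at hpos; simp at hpos
  have hφpos := hφ.lt_of_ne' hφ0
  have hβ0 : β ≠ 0 := by
    intro h0; rw [h0] at hpos; simp at hpos
  have hσ0 : D.sigmaMax ≠ 0 := by
    intro h0; rw [h0] at hpos; simp at hpos
  have hβpos := hβ.lt_of_ne' hβ0
  have hσpos := hσ.lt_of_ne' hσ0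
  -- Over an empty index set the infimum defining the margin takes the default value `0`.
  have hne : Nonempty (Fin N) := by
    by_contra hN
    rw [not_nonempty_iff] at hN
    exact hφ0 (Real.iInf_of_isEmpty _)
  have hn := D.norm_maxMargin_pos hsep
  exact
    { step := fun n => by rw [flat_succ D ℓ η hK, gdStep_eq D hloss.differentiable]
      weight_nonneg := fun n i => by rw [weight]; split_ifs <;> norm_num
      weight_le_one := fun n i => by rw [weight]; split_ifs <;> norm_num
      sum_weight := D.sum_weight hK
      pos := fun x => neg_pos.2 (hloss.deriv_neg x)
      lipschitz := fun x y => by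
        rw [neg_sub_neg, abs_sub_comm]
        exact hloss.smooth x y
      β_pos := hβpos
      σ_pos := hσpos
      φ_pos := hφpos
      η_pos := hη
      one_le_K := hK
      one_le_M := by
        obtain ⟨i⟩ := hne
        exact Nat.succ_le_of_lt ((Nat.zero_le _).trans_lt (D.task i).isLt)
      norm_sum_le := D.norm_sum_smul_signed_le
      separable := by
        refine ⟨‖D.maxMargin‖⁻¹ • D.maxMargin, ?_, fun i => ?_⟩
        · rw [norm_smul, norm_inv, norm_norm, inv_mul_cancel₀ hn.ne']
        · rw [inner_smul_right, inner_signed, ← div_eq_inv_mul]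
          exact D.margin_le i
      nonempty := hne
      rate := by
        rw [lt_div_iff₀ (by positivity)] at hrate
        linarith }

/-- Every step is a combination of data, all of which lie in the support span by the rank condition.
This puts the residual error in the subspace where the support margins are coercive. -/
theorem flat_sub_mem_supportSpan (hspan : D.SupportSpans) {ℓ : ℝ → ℝ}
    (hd : Differentiable ℝ ℓ) (η : ℝ) {K : ℕ} (hK : 1 ≤ K) (w₀ : EuclideanSpace ℝ (Fin d))
    (n : ℕ) : D.flat ℓ η K w₀ n - w₀ ∈ D.supportSpan := by
  induction n with
  | zero => simp [flat, iterate, stageStart]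
  | succ n ih =>
    rw [flat_succ D ℓ η hK, gdStep_eq D hd, add_sub_right_comm]
    exact Submodule.add_mem _ ih (Submodule.smul_mem _ _ (Submodule.sum_mem _ fun i _ =>
      Submodule.smul_mem _ _ (D.signed_mem_supportSpan hspan i)))

end TaskData

/-- The difference is eventually `log (M ⌊t/M⌋ / t)`, and the ratio lies between `1 - M / t` and
`1`. -/
theorem tendsto_log_mul_div_sub_log {K M : ℕ} (hK : 1 ≤ K) (hM : 1 ≤ M) :
    Tendsto (fun t : ℕ => Real.log (K * (t / M : ℕ)) - Real.log ((K : ℝ) / M * t)) atTop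
      (𝓝 0) := by
  have hK0 : (0 : ℝ) < K := by exact_mod_cast hK
  have hM0 : (0 : ℝ) < M := by exact_mod_cast hM
  have h1 : Tendsto (fun t : ℕ => (M * (t / M : ℕ) : ℝ) / t) atTop (𝓝 1) := by
    have h2 : Tendsto (fun t : ℕ => 1 - (M : ℝ) / t) atTop (𝓝 1) := by
      simpa using (tendsto_const_div_atTop_nhds_zero_nat (M : ℝ)).const_sub 1
    refine tendsto_of_tendsto_of_tendsto_of_le_of_le' h2 tendsto_const_nhds ?_ ?_
    · filter_upwards [eventually_gt_atTop 0] with t ht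
      have ht0 : (0 : ℝ) < t := by exact_mod_cast ht
      have h3 : (t : ℝ) ≤ M * (t / M : ℕ) + M := by
        have := Nat.div_add_mod t M
        have := Nat.mod_lt t hM
        exact_mod_cast (by omega : t ≤ M * (t / M) + M)
      rw [le_div_iff₀ ht0, sub_mul, div_mul_cancel₀ _ ht0.ne']
      linarith
    · filter_upwards with t
      refine div_le_one_of_le₀ ?_ (Nat.cast_nonneg t)
      exact_mod_cast Nat.mul_div_le t M
  have h4 := (Real.continuousAt_log one_ne_zero).tendsto.comp h1
  rw [Real.log_one] at h4
  refine h4.congr' ?_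
  filter_upwards [eventually_ge_atTop M] with t ht
  have ht0 : (0 : ℝ) < t := by exact_mod_cast lt_of_lt_of_le hM ht
  have hc : (0 : ℝ) < (t / M : ℕ) := by exact_mod_cast Nat.div_pos ht hM
  rw [Function.comp_apply, ← Real.log_div (by positivity) (by positivity)]
  congr 1
  field_simp

end SeqGD

/-! ### Convergence of the residual. -/

theorem mainTheorem9 {d N M : ℕ} (D : SeqGD.TaskData d N M) (ℓ : ℝ → ℝ) (β η : ℝ) (K : ℕ)
    (w₀ : EuclideanSpace ℝ (Fin d)) (α : Fin N → ℝ)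
    (hK : 1 ≤ K) (hη : 0 < η)
    (hsep : D.Separable) (hnondeg : D.NonDegenerate)
    (hloss : SeqGD.LossShape ℓ β) (htail : SeqGD.TightExponentialTail ℓ)
    (hrate : η < D.margin ^ 2 /
      (2 * K * β * D.sigmaMax ^ 3 * (M * D.margin + D.sigmaMax)))
    (hspan : D.SupportSpans)
    (hα : D.IsDual α) :
    ∃ wt : EuclideanSpace ℝ (Fin d),
      D.ResidualSystem η α w₀ wt ∧ (∀ v, D.ResidualSystem η α w₀ v → v = wt) ∧
        ∀ k < K, Tendsto (fun t => D.residual ℓ η K w₀ t k) atTop (𝓝 wt) := by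
  obtain ⟨wt, hwt⟩ := D.exists_residualSystem hη hnondeg hα w₀
  refine ⟨wt, hwt, fun v hv => SeqGD.TaskData.ResidualSystem.unique D hη hα hv hwt,
    fun k hk => ?_⟩
  have H := D.incrementalDescent w₀ hK hη hsep hloss hrate
  have hne := H.nonempty
  have hM := H.one_le_M
  have hK0 : (0 : ℝ) < K := by exact_mod_cast hK
  set u := D.flat ℓ η K w₀ with hu
  have hd := hloss.differentiable
  have hℓ : ∀ x, deriv ℓ x = -(-deriv ℓ x) := fun x => (neg_neg _).symm
  have hpos : ∀ x, 0 ≤ ℓ x := fun x => (hloss.pos x).le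
  have hinner := H.tendsto_inner_atTop hd hℓ hpos hloss.exists_le_neg_deriv
  obtain ⟨R, hR, hdist⟩ := H.exists_tendsto_bound hd hℓ hpos
  obtain ⟨ε, hε, hcycle⟩ := H.exists_cycle_eq htail.tendsto hinner hR hdist
  obtain ⟨κ, hκ, hcoer⟩ := D.exists_mul_norm_sq_le
  have hmain : Tendsto (fun c : ℕ => u (c * (K * M)) - Real.log (K * c) • D.maxMargin) atTop
      (𝓝 wt) := by
    refine SeqGD.tendsto_sub_log_smul (W := fun c => u (c * (K * M))) hη hK0 hα.1
      (D.maxMargin_eq hα) (fun i hi => (D.mem_supportSet_iff hsep i).1 hi)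
      (fun i hi => lt_of_le_of_ne (D.inner_signed_maxMargin hsep i)
        fun h => hi ((D.mem_supportSet_iff hsep i).2 h.symm))
      (fun i hi => by rw [D.inner_signed]; exact hwt.1 i hi) hε hcycle
      (fun i => Real.tendsto_exp_neg_atTop_nhds_zero.comp (hinner i)) hκ fun c => hcoer _ ?_
    have h1 := D.flat_sub_mem_supportSpan hspan hd η hK w₀ (c * (K * M))
    have h2 := ((D.residualSystem_iff hη hα w₀ wt).1 hwt).2
    have h3 := Submodule.sub_mem _ (Submodule.sub_mem _ h1 h2)
      (Submodule.smul_mem _ (Real.log (K * c)) (D.maxMargin_mem_supportSpan hα))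
    convert h3 using 1
    abel
  have hdiv : Tendsto (fun t : ℕ => t / M) atTop atTop := Nat.tendsto_div_const_atTop (by omega)
  -- The iterate at stage `t`, step `k` sits in cycle `t / M` at offset `(t % M) K + k ≤ K M`, so
  -- the in-cycle displacement bound applies.
  have hclose : Tendsto (fun t : ℕ => D.iterate ℓ η K w₀ t k - u (t / M * (K * M))) atTop
      (𝓝 0) := by
    refine squeeze_zero_norm (fun t => ?_) (hR.comp hdiv)
    have hmod : t % M + 1 ≤ M := Nat.mod_lt t hM
    have h1 : t * K + k = t / M * (K * M) + (t % M * K + k) := by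
      conv_lhs => rw [← Nat.div_add_mod t M]
      ring
    rw [← D.flat_mul_add ℓ η w₀ t hk, h1]
    refine hdist _ _ ?_
    nlinarith [Nat.mul_le_mul_right K hmod]
  have hlog := (SeqGD.tendsto_log_mul_div_sub_log hK hM).smul_const D.maxMargin
  have h := (hclose.add (hmain.comp hdiv)).add hlog
  rw [zero_smul, zero_add, add_zero] at h
  refine h.congr fun t => ?_
  simp only [SeqGD.TaskData.residual, Function.comp_apply, sub_smul]
  abel
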